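/- Let $q\in\mathbb{C}$ with $|q|<1$. Write $(a;q)_n=\prod_{k=0}^{n-1}(1-aq^k)$, $(a;q)_\infty=\prod_{k\ge 0}(1-aq^k)$ and $\theta(z)=\theta(z;q)=(z;q)_\infty(qz^{-1};q)_\infty$ for $z\neq 0$. For $|a_1|,\dots,|a_4|<1$ let $$I_2(a_1,\dots,a_4)=\frac1{2\pi i}\oint_{|z|=1}\frac{(z^2;q)_\infty(z^{-2};q)_\infty}{\prod_{j=1}^4(a_jz;q)_\infty(a_jz^{-1};q)_\infty}\,\frac{dz}{z}.$$ (1) For all nonzero $x_1,\dots,x_4\in\mathbb{C}$ such that $\theta(x_ix_k)\ne0$ and $\theta(x_i/x_k)\neq 0$ for all $i\ne k$, $$\sum_{k=1}^4\frac{\theta(x_k^{-2})}{\prod_{i\ne k}\theta(x_ix_k)\theta(x_i/x_k)}=2\,\frac{\theta(x_1x_2x_3x_4)}{\prod_{1\le i<j\le4}\theta(x_ix_j)}.$$ (2) Assume $q\ne0$, $|a_j|<1$ for $j=1,\dots,4$, $|q|<|a_1a_2a_3a_4|$ and $a_1^2\ne q$. Fix any logarithm of $q$, set $q^w=e^{w\log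 q}$, and write $a_j=q^{s_j}$ (any choice of $s_j$). For $z=q^u$ put $z^w=q^{uw}$ (and $zq^\nu=q^{u+\nu}$), and let $$Q(z)=(z^{-1}-z)\prod_{j=1}^4z^{1/2-s_j}\frac{(qa_j^{-1}z;q)_\infty}{(a_jz;q)_\infty},\qquad h(z)=z^{1-s_1-s_2-s_3-s_4}\frac{\theta(z^2)}{\prod_{j=1}^4\theta(a_jz)},\qquad \mathcal J_2(z)=\frac1{h(z)}\sum_{\nu=-\infty}^{\infty}Q(zq^\nu).$$ Then the series defining $\mathcal J_2(a_1)$, taken with $u=s_1$, converges absolutely, and $$I_2(a_1,\dots,a_4)=\frac{2\,\theta(a_1a_2a_3a_4)}{(q;q)_\infty^2\prod_{1\le i<j\le4}\theta(a_ia_j)}\,\mathcal J_2(a_1),$$ where $\mathcal J_2(a_1)$ is Jackson's very-well-poised ${}_6\varphi_5$ sum, that is, $$\mathcal J_2(a_1)=\frac{\prod_{i=1}^4(qa_1a_i^{-1};q)_\infty(qa_1^{-1}a_i^{-1};q)_\infty}{(qa_1^2;q)_\infty(qa_1^{-2};q)_\infty}\;{}_6\varphi_5\!\left[{qa_1,-qa_1,a_1^2,a_1a_2,a_1a_3,a_1a_4\atop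 a_1,-a_1,qa_1/a_2,qa_1/a_3,qa_1/a_4};q,\frac{q}{a_1a_2a_3a_4}\right]$$ and $$\mathcal J_2(a_1)=\frac{(q;q)_\infty\prod_{1\le j<k\le4}(qa_j^{-1}a_k^{-1};q)_\infty}{(qa_1^{-1}a_2^{-1}a_3^{-1}a_4^{-1};q)_\infty}.$$ Here ${}_{r+1}\varphi_r\!\left[{b_1,\dots,b_{r+1}\atop c_1,\dots,c_r};q,z\right]=\sum_{n\ge0}\frac{(b_1;q)_n\cdots(b_{r+1};q)_n}{(q;q)_n(c_1;q)_n\cdots(c_r;q)_n}z^n$. (3) For all $a_1,\dots,a_4\in\mathbb{C}$ with $|a_j|<1$, $$I_2(a_1,\dots,a_4)=\frac{2\,(a_1a_2a_3a_4;q)_\infty}{(q;q)_\infty\prod_{1\le j<k\le4}(a_ja_k;q)_\infty}.$$ -/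

import Mathlib

/-- The finite `q`-Pochhammer symbol `(a;q)_n = ∏_{k=0}^{n-1} (1 - a q^k)`. -/
noncomputable def qPoch (a q : ℂ) (n : ℕ) : ℂ :=
  ∏ k ∈ Finset.range n, (1 - a * q ^ k)

/-- The infinite `q`-Pochhammer symbol `(a;q)_∞ = ∏_{k≥0} (1 - a q^k)`
(an absolutely convergent product for `|q| < 1`). -/
noncomputable def qPochInf (a q : ℂ) : ℂ :=
  ∏' k : ℕ, (1 - a * q ^ k)

/-- The theta function `θ(z;q) = (z;q)_∞ (q z⁻¹;q)_∞`. -/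
noncomputable def qTheta (z q : ℂ) : ℂ :=
  qPochInf z q * qPochInf (q * z⁻¹) q

/-- The basic hypergeometric series `_{r+1}φ_r[a; b; q, z]`. -/
noncomputable def basicHyp {r : ℕ} (a : Fin (r + 1) → ℂ) (b : Fin r → ℂ) (q z : ℂ) : ℂ :=
  ∑' n : ℕ, (∏ i, qPoch (a i) q n) / (qPoch q q n * ∏ i, qPoch (b i) q n) * z ^ n

/-- The Askey-Wilson integral
`I₂ = (2πi)⁻¹ ∫_{|z|=1} (z^{±2};q)_∞ / ∏_j (a_j z^{±1};q)_∞ dz/z`. -/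
noncomputable def askeyWilsonIntegral (q : ℂ) (a : Fin 4 → ℂ) : ℂ :=
  (2 * (Real.pi : ℂ) * Complex.I)⁻¹ *
    ∮ z in C(0, 1),
      z⁻¹ * ((qPochInf (z ^ 2) q * qPochInf ((z ^ 2)⁻¹) q) /
        ∏ j, (qPochInf (a j * z) q * qPochInf (a j * z⁻¹) q))

/-- The power `q^w = exp (τ w)` for the branch `log q = τ`. -/
noncomputable def qPow (τ w : ℂ) : ℂ := Complex.exp (τ * w)

/-- With `q = exp τ`, `a_j = q^{s_j}` and `z = q^u`, the function
`Q(z) = (z⁻¹ - z) ∏_{j=1}^4 z^{1/2 - s_j} (q a_j⁻¹ z;q)_∞ / (a_j z;q)_∞`,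
where `z^w` means `q^{u w}`. -/
noncomputable def jacksonQ (τ : ℂ) (s : Fin 4 → ℂ) (u : ℂ) : ℂ :=
  ((qPow τ u)⁻¹ - qPow τ u) *
    ∏ j, (qPow τ (u * (1 / 2 - s j)) *
      (qPochInf (Complex.exp τ * (qPow τ (s j))⁻¹ * qPow τ u) (Complex.exp τ) /
        qPochInf (qPow τ (s j) * qPow τ u) (Complex.exp τ)))

/-- The bilateral Jackson integral `J₂(z) = ∑_{ν ∈ ℤ} Q(z q^ν)` at `z = q^u`. -/
noncomputable def jacksonJ (τ : ℂ) (s : Fin 4 → ℂ) (u : ℂ) : ℂ :=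
  ∑' ν : ℤ, jacksonQ τ s (u + (ν : ℂ))

/-- The factor `h(z) = z^{1 - s_1 - s_2 - s_3 - s_4} θ(z²;q) / ∏_j θ(a_j z;q)` at `z = q^u`. -/
noncomputable def jacksonH (τ : ℂ) (s : Fin 4 → ℂ) (u : ℂ) : ℂ :=
  qPow τ (u * (1 - ∑ j, s j)) *
    (qTheta (qPow τ u ^ 2) (Complex.exp τ) /
      ∏ j, qTheta (qPow τ (s j) * qPow τ u) (Complex.exp τ))

/-- The regularised Jackson integral `𝒥₂(z) = J₂(z) / h(z)` at `z = q^u`. -/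
noncomputable def jacksonReg (τ : ℂ) (s : Fin 4 → ℂ) (u : ℂ) : ℂ :=
  jacksonJ τ s u / jacksonH τ s u

open Filter Topology

/-! The three claims are proved by three separate arguments; the theta identity is not used for the
other two.

Theta identity. Fix three of the points b, c, d and regard the difference of the two sides as a
function of the fourth, x. Over the common denominator P(x) = ∏ θ(xv)θ(x/v), v ∈ {b, c, d}, it is
N/P with N = `thetaNumerator`. Here N(qx) = x⁻⁴N(x) and P(qx) = x⁻⁶P(x), so g = N/P satisfies g(qz)
= z²g(z). Generically P has only simple zeros and N vanishes at each of them, so g is holomorphic on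
ℂ∖{0}. The functional equation bounds |g| by its maximum on one annulus, the maximum principle makes
g constant, and the equation forces that constant to be 0. The exceptional cases θ(x_k²) = 0 and q =
0 follow by continuity.

Jackson's sum. The ₆φ₅ series is written in t = d⁻¹, d being its last parameter, so that d = ∞
becomes the ordinary point t = 0. A telescoping relation links the series at t and at qt
(`sum_vwpTerm_sub`). Iterating it compares t with 0; since the series is 1 at t = 1, comparing 1
with 0 as well eliminates the value at 0 (`tsum_vwpTerm`). At z = a₁ the bilateral sum is one-sided,
and its terms are those of this series (`jacksonQ_add_natCast`).

Askey-Wilson integral. The integrands for a and qa are related up to a q-difference, which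
integrates to zero by Cauchy's theorem on |q| ≤ |z| ≤ 1 (`awIntegral_mul_base`). Doing this in all
four parameters shows that the integral divided by its expected parameter dependence is unchanged
when every parameter is multiplied by q; in the limit it is a constant
(`awRatio_eq_zero_parameters`). The constant is read off at the parameters (q, −q, √q, −√q), where
the integrand is a Laurent polynomial. The case q = 0 is again a limit.

The relation between the integral and `jacksonReg` then follows by comparing the two product
formulas, using θ(a_i a_j) = (a_i a_j; q)_∞ (q/(a_i a_j); q)_∞. -/

/-! ### Infinite q-Pochhammer symbols: continuity, holomorphy, zeros -/

theorem summable_norm_mul_pow {q : ℂ} (hq : ‖q‖ < 1) (a : ℂ) :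
    Summable fun k : ℕ => ‖a * q ^ k‖ := by
  simpa [norm_mul, norm_pow] using
    (summable_geometric_of_lt_one (norm_nonneg q) hq).mul_left ‖a‖

theorem multipliable_qPochInf {q : ℂ} (hq : ‖q‖ < 1) (a : ℂ) :
    Multipliable fun k : ℕ => 1 - a * q ^ k := by
  have := multipliable_one_add_of_summable (f := fun k : ℕ => -(a * q ^ k))
    (by simpa only [norm_neg] using summable_norm_mul_pow hq a)
  simpa only [← sub_eq_add_neg] using this

/-- Continuity is joint in both variables because q = 0 is later reached as a limit of nonzero q.
Near (a, q) the factors differ from 1 by at most (‖a‖ + 1)rᵏ with ‖q‖ < r < 1, so the product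
converges uniformly. -/
theorem continuousAt_qPochInf (a : ℂ) {q : ℂ} (hq : ‖q‖ < 1) :
    ContinuousAt (fun p : ℂ × ℂ => qPochInf p.1 p.2) (a, q) := by
  obtain ⟨r, hqr, hr1⟩ := exists_between hq
  set K : Set (ℂ × ℂ) := Metric.ball 0 (‖a‖ + 1) ×ˢ Metric.ball 0 r
  have hK : IsOpen K := Metric.isOpen_ball.prod Metric.isOpen_ball
  have hr0 : 0 ≤ r := (norm_nonneg q).trans hqr.le
  have hmem : (a, q) ∈ K := by simp [K, hqr]
  have h := Summable.hasProdLocallyUniformlyOn_nat_one_add (K := K)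
    (f := fun (k : ℕ) (p : ℂ × ℂ) => -(p.1 * p.2 ^ k)) hK
    ((summable_geometric_of_lt_one hr0 hr1).mul_left (‖a‖ + 1))
    (Eventually.of_forall fun k p hp => by
      simp only [K, Set.mem_prod, mem_ball_zero_iff] at hp
      rw [norm_neg, norm_mul, norm_pow]
      gcongr
      · exact hp.1.le
      · exact hp.2.le)
    (fun k => by fun_prop)
  have hc := h.tendstoLocallyUniformlyOn_finsetRange.continuousOn
    (Frequently.of_forall fun n => by fun_prop)
  refine ((hc.continuousAt (hK.mem_nhds hmem)).congr ?_)
  exact Eventually.of_forall fun p => by simp [qPochInf, sub_eq_add_neg]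

theorem differentiable_qPochInf {q : ℂ} (hq : ‖q‖ < 1) :
    Differentiable ℂ fun a => qPochInf a q := by
  intro a
  have hK : IsOpen (Metric.ball (0 : ℂ) (‖a‖ + 1)) := Metric.isOpen_ball
  have h := Summable.hasProdLocallyUniformlyOn_nat_one_add (K := Metric.ball (0 : ℂ) (‖a‖ + 1))
    (f := fun (k : ℕ) (z : ℂ) => -(z * q ^ k)) hK
    ((summable_geometric_of_lt_one (norm_nonneg q) hq).mul_left (‖a‖ + 1))
    (Eventually.of_forall fun k z hz => by
      simp only [mem_ball_zero_iff] at hz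
      rw [norm_neg, norm_mul, norm_pow]
      gcongr)
    (fun k => by fun_prop)
  have hd := h.tendstoLocallyUniformlyOn_finsetRange.differentiableOn
    (Eventually.of_forall fun n => by fun_prop) hK
  refine (hd.differentiableAt (hK.mem_nhds (by simp))).congr_of_eventuallyEq ?_
  exact Eventually.of_forall fun p => by simp [qPochInf, sub_eq_add_neg]

theorem qPochInf_zero_left (q : ℂ) : qPochInf 0 q = 1 := by simp [qPochInf]

theorem qPoch_zero (a q : ℂ) : qPoch a q 0 = 1 := by simp [qPoch]

theorem qPoch_succ (a q : ℂ) (n : ℕ) : qPoch a q (n + 1) = qPoch a q n * (1 - a * q ^ n) := by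
  simp [qPoch, Finset.prod_range_succ]

theorem qPochInf_eq_qPoch_mul {q : ℂ} (hq : ‖q‖ < 1) (a : ℂ) (n : ℕ) :
    qPochInf a q = qPoch a q n * qPochInf (a * q ^ n) q := by
  have he : (fun k : ℕ => 1 - a * q ^ (k + n)) = fun k : ℕ => 1 - a * q ^ n * q ^ k :=
    funext fun k => by rw [pow_add]; ring
  have hm : Multipliable fun k : ℕ => 1 - a * q ^ (k + n) :=
    he ▸ multipliable_qPochInf hq (a * q ^ n)
  have h := Multipliable.prod_mul_tprod_nat_mul' (f := fun k : ℕ => 1 - a * q ^ k) hm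
  rw [he] at h
  exact h.symm

theorem qPochInf_eq_one_sub_mul {q : ℂ} (hq : ‖q‖ < 1) (a : ℂ) :
    qPochInf a q = (1 - a) * qPochInf (a * q) q := by
  simpa [qPoch] using qPochInf_eq_qPoch_mul hq a 1

theorem qPochInf_eq_zero_iff {q : ℂ} (hq : ‖q‖ < 1) (a : ℂ) :
    qPochInf a q = 0 ↔ ∃ k : ℕ, a * q ^ k = 1 := by
  constructor
  · intro h
    by_contra! hne
    refine tprod_one_add_ne_zero_of_summable (f := fun k : ℕ => -(a * q ^ k)) (fun k hk => ?_)
      (by simpa only [norm_neg] using summable_norm_mul_pow hq a) ?_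
    · exact hne k (by linear_combination -hk)
    · simpa [qPochInf, sub_eq_add_neg] using h
  · rintro ⟨k, hk⟩
    rw [qPochInf_eq_qPoch_mul hq a (k + 1), qPoch_succ, hk]
    simp

theorem qPochInf_ne_zero {q : ℂ} (hq : ‖q‖ < 1) {a : ℂ} (ha : ‖a‖ < 1) : qPochInf a q ≠ 0 := by
  rw [Ne, qPochInf_eq_zero_iff hq]
  rintro ⟨k, hk⟩
  have h1 : ‖a‖ * ‖q‖ ^ k = 1 := by rw [← norm_pow, ← norm_mul, hk, norm_one]
  have h2 : ‖q‖ ^ k ≤ 1 := pow_le_one₀ (norm_nonneg q) hq.le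
  nlinarith [norm_nonneg a, pow_nonneg (norm_nonneg q) k]

theorem qPoch_ne_zero {q a : ℂ} (h : ∀ k : ℕ, a * q ^ k ≠ 1) (n : ℕ) : qPoch a q n ≠ 0 :=
  Finset.prod_ne_zero_iff.2 fun k _ hk => h k (by linear_combination -hk)

/-- Splitting `(x²;q)_∞` into base-`q` products of `±x` and `±rx`, where `r² = q`. -/
theorem qPochInf_sq {q r : ℂ} (hq : ‖q‖ < 1) (hr : r ^ 2 = q) (x : ℂ) :
    qPochInf (x ^ 2) q =
      qPochInf x q * qPochInf (-x) q * (qPochInf (r * x) q * qPochInf (-(r * x)) q) := by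
  have h1 : ∀ y : ℂ, HasProd (fun k : ℕ => 1 - y ^ 2 * q ^ (2 * k))
      (qPochInf y q * qPochInf (-y) q) := fun y => by
    have h := (multipliable_qPochInf hq y).hasProd.mul (multipliable_qPochInf hq (-y)).hasProd
    have he : (fun k : ℕ => 1 - y ^ 2 * q ^ (2 * k)) =
        fun k : ℕ => (1 - y * q ^ k) * (1 - -y * q ^ k) := funext fun k => by ring
    rw [he]
    exact h
  have h2 : HasProd (fun k : ℕ => 1 - x ^ 2 * q ^ (2 * k + 1))
      (qPochInf (r * x) q * qPochInf (-(r * x)) q) := by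
    have he : (fun k : ℕ => 1 - x ^ 2 * q ^ (2 * k + 1)) =
        fun k : ℕ => 1 - (r * x) ^ 2 * q ^ (2 * k) := funext fun k => by
      rw [mul_pow, hr]; ring
    rw [he]
    exact h1 (r * x)
  exact (HasProd.even_mul_odd (f := fun k : ℕ => 1 - x ^ 2 * q ^ k) (h1 x) h2).tprod_eq

theorem qPochInf_self_ne_zero {q : ℂ} (hq : ‖q‖ < 1) : qPochInf q q ≠ 0 := qPochInf_ne_zero hq hq

theorem continuous_qPochInf {q : ℂ} (hq : ‖q‖ < 1) : Continuous fun a => qPochInf a q :=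
  (differentiable_qPochInf hq).continuous

/-! ### The theta function: quasi-periodicity and simple zeros -/

theorem qTheta_mul_base {q z : ℂ} (hq : ‖q‖ < 1) (hq0 : q ≠ 0) (hz : z ≠ 0) :
    qTheta (q * z) q = -z⁻¹ * qTheta z q := by
  have h1 : q * (q * z)⁻¹ = z⁻¹ := by field_simp
  rw [qTheta, qTheta, h1, qPochInf_eq_one_sub_mul hq z, qPochInf_eq_one_sub_mul hq z⁻¹,
    mul_comm z⁻¹ q, mul_comm z q]
  field_simp
  ring

theorem qTheta_inv {q z : ℂ} (hq : ‖q‖ < 1) (hz : z ≠ 0) :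
    qTheta z⁻¹ q = -z⁻¹ * qTheta z q := by
  rw [qTheta, qTheta, inv_inv, qPochInf_eq_one_sub_mul hq z, qPochInf_eq_one_sub_mul hq z⁻¹,
    mul_comm z⁻¹ q, mul_comm z q]
  field_simp
  ring

theorem qTheta_one {q : ℂ} (hq : ‖q‖ < 1) : qTheta 1 q = 0 := by
  rw [qTheta, qPochInf_eq_one_sub_mul hq]
  simp

theorem continuousAt_qTheta {z q : ℂ} (hq : ‖q‖ < 1) (hz : z ≠ 0) :
    ContinuousAt (fun p : ℂ × ℂ => qTheta p.1 p.2) (z, q) := by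
  have h1 : ContinuousAt (fun p : ℂ × ℂ => qPochInf p.1 p.2) (z, q) := continuousAt_qPochInf z hq
  have h2 : ContinuousAt (fun p : ℂ × ℂ => (p.2 * p.1⁻¹, p.2)) (z, q) :=
    (continuousAt_snd.mul (continuousAt_fst.inv₀ hz)).prodMk continuousAt_snd
  exact h1.mul (ContinuousAt.comp (g := fun p : ℂ × ℂ => qPochInf p.1 p.2)
    (f := fun p : ℂ × ℂ => (p.2 * p.1⁻¹, p.2)) (continuousAt_qPochInf _ hq) h2)

theorem tendsto_qTheta {α : Type*} {l : Filter α} {f g : α → ℂ} {z q : ℂ} (hq : ‖q‖ < 1)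
    (hz : z ≠ 0) (hf : Tendsto f l (𝓝 z)) (hg : Tendsto g l (𝓝 q)) :
    Tendsto (fun x => qTheta (f x) (g x)) l (𝓝 (qTheta z q)) :=
  Tendsto.comp (g := fun p : ℂ × ℂ => qTheta p.1 p.2) (f := fun x => (f x, g x))
    (y := 𝓝 (z, q)) (continuousAt_qTheta hq hz) (hf.prodMk_nhds hg)

theorem differentiableAt_qTheta {q z : ℂ} (hq : ‖q‖ < 1) (hz : z ≠ 0) :
    DifferentiableAt ℂ (fun z => qTheta z q) z :=
  (differentiable_qPochInf hq z).mul
    ((differentiable_qPochInf hq _).comp z ((differentiableAt_inv hz).const_mul q))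

theorem qTheta_eq_zero_iff {q z : ℂ} (hq : ‖q‖ < 1) (hq0 : q ≠ 0) (hz : z ≠ 0) :
    qTheta z q = 0 ↔ ∃ m : ℤ, z = q ^ m := by
  rw [qTheta, mul_eq_zero, qPochInf_eq_zero_iff hq, qPochInf_eq_zero_iff hq]
  constructor
  · rintro (⟨k, hk⟩ | ⟨k, hk⟩)
    · exact ⟨-k, by rw [zpow_neg, zpow_natCast]; exact eq_inv_of_mul_eq_one_left hk⟩
    · refine ⟨k + 1, ?_⟩
      have : z * (q * z⁻¹ * q ^ k) = z := by rw [hk, mul_one]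
      rw [← this]
      norm_cast
      field_simp
      ring
  · rintro ⟨m, rfl⟩
    rcases Int.lt_or_le 0 m with hm | hm
    · obtain ⟨k, rfl⟩ : ∃ k : ℕ, m = k + 1 := ⟨(m - 1).toNat, by omega⟩
      refine Or.inr ⟨k, ?_⟩
      norm_cast
      field_simp
      ring
    · obtain ⟨k, rfl⟩ : ∃ k : ℕ, m = -k := ⟨(-m).toNat, by omega⟩
      exact Or.inl ⟨k, by rw [zpow_neg, zpow_natCast]; field_simp⟩

theorem qTheta_div_eq_zero {q u v : ℂ} (hq : ‖q‖ < 1) (hq0 : q ≠ 0) (hu : u ≠ 0) (hv : v ≠ 0)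
    (h1 : qTheta u q = 0) (h2 : qTheta v q = 0) : qTheta (u / v) q = 0 := by
  rw [qTheta_eq_zero_iff hq hq0 hu] at h1
  rw [qTheta_eq_zero_iff hq hq0 hv] at h2
  obtain ⟨m, rfl⟩ := h1
  obtain ⟨n, rfl⟩ := h2
  exact (qTheta_eq_zero_iff hq hq0 (div_ne_zero hu hv)).2 ⟨m - n, by rw [zpow_sub₀ hq0]⟩

/-- The zeros qᵐ are simple. At 1 this is visible from the factor 1 − z; differentiating θ(qz) =
−z⁻¹θ(z) at a zero carries it from qᵐ to qᵐ⁺¹ and back. -/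
theorem deriv_qTheta_ne_zero {q z : ℂ} (hq : ‖q‖ < 1) (hq0 : q ≠ 0) (hz : z ≠ 0)
    (h : qTheta z q = 0) : deriv (fun z => qTheta z q) z ≠ 0 := by
  have hone : deriv (fun z => qTheta z q) 1 ≠ 0 := by
    have hf : (fun z => qTheta z q) =
        fun z => (1 - z) * (qPochInf (z * q) q * qPochInf (q * z⁻¹) q) := by
      ext z
      rw [qTheta, qPochInf_eq_one_sub_mul hq z]
      ring
    have hd : DifferentiableAt ℂ (fun z => qPochInf (z * q) q * qPochInf (q * z⁻¹) q) 1 :=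
      DifferentiableAt.mul
        ((differentiable_qPochInf hq _).comp (1 : ℂ) (differentiableAt_id.mul_const q))
        ((differentiable_qPochInf hq _).comp (1 : ℂ) ((differentiableAt_inv one_ne_zero).const_mul q))
    have := (((hasDerivAt_id (1 : ℂ)).const_sub 1).mul hd.hasDerivAt).deriv
    rw [hf]
    refine (this.trans ?_).trans_ne
      (neg_ne_zero.2 (mul_ne_zero (qPochInf_self_ne_zero hq) (qPochInf_self_ne_zero hq)))
    simp
  have step : ∀ w : ℂ, w ≠ 0 → qTheta w q = 0 →
      q * deriv (fun z => qTheta z q) (q * w) = -w⁻¹ * deriv (fun z => qTheta z q) w := by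
    intro w hw h0
    have h1 : HasDerivAt (fun z => qTheta (q * z) q) (deriv (fun z => qTheta z q) (q * w) * q) w := by
      have := (differentiableAt_qTheta hq (mul_ne_zero hq0 hw)).hasDerivAt
      exact HasDerivAt.comp (h₂ := fun z => qTheta z q) (h := fun z => q * z) w this
        (by simpa using (hasDerivAt_id w).const_mul q)
    have h2 := ((hasDerivAt_inv hw).neg).mul (differentiableAt_qTheta hq hw).hasDerivAt
    have h3 : (fun z => qTheta (q * z) q) =ᶠ[𝓝 w] fun z => -z⁻¹ * qTheta z q := by
      filter_upwards [isOpen_ne.mem_nhds hw] with z hz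
      exact qTheta_mul_base hq hq0 hz
    have := h1.unique (h2.congr_of_eventuallyEq h3)
    rw [mul_comm, this, h0]
    simp
  obtain ⟨m, rfl⟩ := (qTheta_eq_zero_iff hq hq0 hz).1 h
  have hzero : ∀ m : ℤ, qTheta (q ^ m) q = 0 := fun m =>
    (qTheta_eq_zero_iff hq hq0 (zpow_ne_zero m hq0)).2 ⟨m, rfl⟩
  have hiff : ∀ m : ℤ, deriv (fun z => qTheta z q) (q ^ (m + 1)) ≠ 0 ↔
      deriv (fun z => qTheta z q) (q ^ m) ≠ 0 := by
    intro m
    have := step (q ^ m) (zpow_ne_zero m hq0) (hzero m)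
    rw [zpow_add_one₀ hq0, mul_comm (q ^ m) q]
    have hn : -(q ^ m)⁻¹ ≠ 0 := neg_ne_zero.2 (inv_ne_zero (zpow_ne_zero m hq0))
    rw [← mul_ne_zero_iff_left hq0, this, mul_ne_zero_iff_left hn]
  clear h hz
  induction m using Int.induction_on with
  | zero => simpa using hone
  | succ n ih => exact (hiff n).2 ih
  | pred n ih =>
    have := hiff (-n - 1)
    rw [sub_add_cancel] at this
    exact this.1 ih

/-! ### A Liouville argument for quasi-periodic functions on ℂ∖{0} -/

/-- The multiplier z² has modulus at most 1 inside the unit disc and at least 1 outside, so moving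
away from the annulus ‖q‖ ≤ ‖z‖ ≤ 1 in either direction cannot increase ‖g‖. The maximum over the
annulus is thus global, and the maximum principle applies. -/
theorem eq_zero_of_mul_base_eq_sq_mul {q : ℂ} (hq : ‖q‖ < 1) (hq0 : q ≠ 0) {g : ℂ → ℂ}
    (hd : ∀ z, z ≠ 0 → DifferentiableAt ℂ g z) (hg : ∀ z, z ≠ 0 → g (q * z) = z ^ 2 * g z)
    {z : ℂ} (hz : z ≠ 0) : g z = 0 := by
  set A : Set ℂ := Metric.closedBall 0 1 \ Metric.ball 0 ‖q‖
  have hA : IsCompact A := (isCompact_closedBall 0 1).diff Metric.isOpen_ball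
  have hA0 : ∀ w ∈ A, w ≠ 0 := by
    rintro w hw rfl
    exact hw.2 (by simpa using hq0)
  have h1A : (1 : ℂ) ∈ A := by simp [A, hq.le]
  obtain ⟨c, hcA, hc⟩ := hA.exists_isMaxOn ⟨1, h1A⟩
    (f := fun z => ‖g z‖) (fun w hw => (hd w (hA0 w hw)).continuousAt.norm.continuousWithinAt)
  have hq0' : 0 < ‖q‖ := norm_pos_iff.2 hq0
  -- Inward: for ‖w‖ below the annulus, g(w) = (w/q)²g(w/q) with ‖w/q‖ ≤ 1.
  have hin : ∀ n : ℕ, ∀ w : ℂ, ‖q‖ ^ (n + 1) ≤ ‖w‖ → ‖w‖ ≤ 1 → ‖g w‖ ≤ ‖g c‖ := by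
    intro n
    induction n with
    | zero => exact fun w h1 h2 => hc (by simpa [A] using ⟨h2, by simpa using h1⟩)
    | succ n ih =>
      intro w h1 h2
      by_cases h3 : ‖q‖ ^ (n + 1) ≤ ‖w‖
      · exact ih w h3 h2
      have hw : ‖w / q‖ ≤ 1 := by
        rw [norm_div, div_le_one hq0']
        refine (not_le.1 h3).le.trans ?_
        rw [pow_succ]
        exact mul_le_of_le_one_left hq0'.le (pow_le_one₀ hq0'.le hq.le)
      have hw0 : w / q ≠ 0 := by
        refine div_ne_zero (norm_pos_iff.1 ?_) hq0
        exact (pow_pos hq0' _).trans_le h1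
      have h4 : g w = (w / q) ^ 2 * g (w / q) := by
        rw [← hg _ hw0, mul_div_cancel₀ _ hq0]
      have h5 := ih (w / q) (by rw [norm_div, le_div_iff₀ hq0', ← pow_succ]; exact h1) hw
      rw [h4, norm_mul, norm_pow]
      exact (mul_le_of_le_one_left (norm_nonneg _) (pow_le_one₀ (norm_nonneg _) hw)).trans h5
  -- Outward: for ‖w‖ ≥ 1, ‖g(w)‖ ≤ ‖w²g(w)‖ = ‖g(qw)‖, and qw is closer to the annulus.
  have hout : ∀ n : ℕ, ∀ w : ℂ, 1 ≤ ‖w‖ → ‖q‖ ^ n * ‖w‖ ≤ 1 → ‖g w‖ ≤ ‖g c‖ := by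
    intro n
    induction n with
    | zero => exact fun w h1 h2 => hin 0 w (by simpa using hq.le.trans h1) (by simpa using h2)
    | succ n ih =>
      intro w h1 h2
      have hw0 : w ≠ 0 := norm_pos_iff.1 (one_pos.trans_le h1)
      have h4 : ‖g w‖ ≤ ‖g (q * w)‖ := by
        rw [hg w hw0, norm_mul, norm_pow]
        exact le_mul_of_one_le_left (norm_nonneg _) (one_le_pow₀ h1)
      refine h4.trans ?_
      rcases le_total 1 ‖q * w‖ with h5 | h5
      · exact ih _ h5 (by rw [norm_mul, ← mul_assoc, ← pow_succ]; exact h2)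
      · exact hin 0 _ (by rw [norm_mul, zero_add, pow_one]; exact le_mul_of_one_le_right hq0'.le h1) h5
  have hall : ∀ w : ℂ, w ≠ 0 → ‖g w‖ ≤ ‖g c‖ := by
    intro w hw
    have hw' : 0 < ‖w‖ := norm_pos_iff.2 hw
    rcases le_total 1 ‖w‖ with h | h
    · obtain ⟨n, hn⟩ := exists_pow_lt_of_lt_one (inv_pos.2 hw') hq
      exact hout n w h ((le_inv_mul_iff₀' hw').1 (by simpa using hn.le))
    · obtain ⟨n, hn⟩ := exists_pow_lt_of_lt_one hw' hq
      exact hin n w ((pow_le_pow_of_le_one hq0'.le hq.le n.le_succ).trans hn.le) h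
  have hconst : ∀ w : ℂ, w ≠ 0 → g w = g c := fun w hw =>
    Complex.eqOn_of_isPreconnected_of_isMaxOn_norm (U := {0}ᶜ)
      (isConnected_compl_singleton_of_one_lt_rank (by simp) _).isPreconnected
      isOpen_compl_singleton (fun w hw => (hd w hw).differentiableWithinAt) (hA0 c hcA)
      (fun w hw => hall w hw) hw
  -- Any point with z² ≠ 1 would do: the constant value C now satisfies C = 4C.
  have h2 := hg 2 two_ne_zero
  rw [hconst _ (mul_ne_zero hq0 two_ne_zero), hconst 2 two_ne_zero] at h2
  rw [hconst z hz]
  linear_combination (-1 / 3) * h2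

/-- Removable singularities with explicit values: near a common zero, N/P is the quotient of the
difference slopes `dslope`, which are holomorphic, and the denominator slope is nonzero because the
zero of P is simple. -/
theorem exists_differentiableAt_mul_eq {U : Set ℂ} (hU : IsOpen U) {N P : ℂ → ℂ}
    (hN : DifferentiableOn ℂ N U) (hP : DifferentiableOn ℂ P U)
    (h : ∀ z ∈ U, P z = 0 → N z = 0 ∧ deriv P z ≠ 0) {z : ℂ} (hz : z ∈ U) :
    DifferentiableAt ℂ (fun z => if P z = 0 then deriv N z / deriv P z else N z / P z) z := by
  by_cases h0 : P z = 0
  · obtain ⟨hN0, hP0⟩ := h z hz h0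
    have hd : DifferentiableAt ℂ (fun w => dslope N z w / dslope P z w) z := by
      refine DifferentiableAt.fun_div ?_ ?_ (by simpa using hP0)
      · exact ((Complex.differentiableOn_dslope (hU.mem_nhds hz)).2 hN).differentiableAt
          (hU.mem_nhds hz)
      · exact ((Complex.differentiableOn_dslope (hU.mem_nhds hz)).2 hP).differentiableAt
          (hU.mem_nhds hz)
    refine hd.congr_of_eventuallyEq ?_
    have hne : ∀ᶠ w in 𝓝[≠] z, P w ≠ 0 :=
      (hP.differentiableAt (hU.mem_nhds hz)).hasDerivAt.eventually_ne hP0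
    rw [eventually_nhdsWithin_iff] at hne
    filter_upwards [hne] with w hw
    by_cases hwz : w = z
    · subst hwz
      simp [h0]
    · have hzw : w - z ≠ 0 := sub_ne_zero.2 hwz
      rw [if_neg (hw hwz), dslope_of_ne _ hwz, dslope_of_ne _ hwz, slope_def_field,
        slope_def_field, h0, hN0, sub_zero, sub_zero, div_div_div_cancel_right₀ hzw]
  · have hc : ∀ᶠ w in 𝓝 z, P w ≠ 0 :=
      (hP.differentiableAt (hU.mem_nhds hz)).continuousAt.eventually_ne h0
    refine ((hN.differentiableAt (hU.mem_nhds hz)).fun_div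
      (hP.differentiableAt (hU.mem_nhds hz)) h0).congr_of_eventuallyEq ?_
    filter_upwards [hc] with w hw
    rw [if_neg hw]

theorem eq_zero_of_theta_quotient {q : ℂ} (hq : ‖q‖ < 1) (hq0 : q ≠ 0) {N P : ℂ → ℂ}
    (hN : DifferentiableOn ℂ N {0}ᶜ) (hP : DifferentiableOn ℂ P {0}ᶜ)
    (h : ∀ z, z ≠ 0 → P z = 0 → N z = 0 ∧ deriv P z ≠ 0)
    (hNq : ∀ z, z ≠ 0 → N (q * z) = (z ^ 4)⁻¹ * N z)
    (hPq : ∀ z, z ≠ 0 → P (q * z) = (z ^ 6)⁻¹ * P z) {z : ℂ} (hz : z ≠ 0) (hPz : P z ≠ 0) :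
    N z = 0 := by
  -- At a zero w of F the derivative obeys the multiplier law of F up to the factor q. That factor
  -- cancels in N'/P', so the filled-in values satisfy the same functional equation as N/P.
  have hdq : ∀ (F : ℂ → ℂ) (n : ℕ), DifferentiableOn ℂ F {0}ᶜ →
      (∀ z, z ≠ 0 → F (q * z) = (z ^ n)⁻¹ * F z) → ∀ w, w ≠ 0 → F w = 0 →
      deriv F (q * w) * q = (w ^ n)⁻¹ * deriv F w := by
    intro F n hF hFq w hw h0
    have h1 : HasDerivAt (fun z => F (q * z)) (deriv F (q * w) * q) w :=
      HasDerivAt.comp (h₂ := F) (h := fun z => q * z) w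
        (hF.differentiableAt (isOpen_compl_singleton.mem_nhds (mul_ne_zero hq0 hw))).hasDerivAt
        (by simpa using (hasDerivAt_id w).const_mul q)
    have h2 : DifferentiableAt ℂ (fun z : ℂ => (z ^ n)⁻¹) w :=
      (differentiableAt_pow n).fun_inv (pow_ne_zero n hw)
    have h3 := h2.hasDerivAt.mul
      (hF.differentiableAt (isOpen_compl_singleton.mem_nhds hw)).hasDerivAt
    have h4 : (fun z => F (q * z)) =ᶠ[𝓝 w] fun z => (z ^ n)⁻¹ * F z := by
      filter_upwards [isOpen_ne.mem_nhds hw] with z hz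
      exact hFq z hz
    rw [h1.unique (h3.congr_of_eventuallyEq h4), h0]
    simp
  have key := eq_zero_of_mul_base_eq_sq_mul hq hq0
    (g := fun z => if P z = 0 then deriv N z / deriv P z else N z / P z)
    (fun w hw => exists_differentiableAt_mul_eq isOpen_compl_singleton hN hP h hw) ?_ hz
  · simpa [hPz] using key
  intro w hw
  have hiff : P (q * w) = 0 ↔ P w = 0 := by simp [hPq w hw, hw]
  simp only [hiff]
  split_ifs with h0
  · have h1 := hdq N 4 hN hNq w hw (h w hw h0).1
    have h2 := hdq P 6 hP hPq w hw h0
    have h3 := (h w hw h0).2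
    have h4 : deriv P (q * w) ≠ 0 := (h _ (mul_ne_zero hq0 hw) (hiff.2 h0)).2
    have h1' : deriv N (q * w) = (w ^ 4)⁻¹ * deriv N w / q := by rw [← h1]; field_simp
    have h2' : deriv P (q * w) = (w ^ 6)⁻¹ * deriv P w / q := by rw [← h2]; field_simp
    rw [h1', h2']
    field_simp
  · rw [hNq w hw, hPq w hw]
    field_simp

/-! ### The theta function identity -/

/-- The product `θ(uv) θ(u/v)`. -/
noncomputable def thetaPair (q u v : ℂ) : ℂ := qTheta (u * v) q * qTheta (u / v) q

/-- The difference of the two sides of the theta function identity, cleared of the denominators that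
involve `x`. -/
noncomputable def thetaNumerator (q b c d x : ℂ) : ℂ :=
  -(x ^ 3 / (b * c * d)) * qTheta ((x ^ 2)⁻¹) q +
    (qTheta ((b ^ 2)⁻¹) q * (thetaPair q x c * thetaPair q x d / (thetaPair q c b * thetaPair q d b)) +
      qTheta ((c ^ 2)⁻¹) q * (thetaPair q x b * thetaPair q x d / (thetaPair q b c * thetaPair q d c)) +
      qTheta ((d ^ 2)⁻¹) q * (thetaPair q x b * thetaPair q x c / (thetaPair q b d * thetaPair q c d))) -
    2 * (qTheta (x * b * c * d) q * (qTheta (x / b) q * qTheta (x / c) q * qTheta (x / d) q) /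
      (qTheta (b * c) q * qTheta (b * d) q * qTheta (c * d) q))

theorem thetaNumerator_rotate (q b c d x : ℂ) :
    thetaNumerator q b c d x = thetaNumerator q c d b x := by
  rw [thetaNumerator, thetaNumerator, mul_comm c b, mul_comm d b,
    show c * d * b = b * c * d by ring, show x * c * d * b = x * b * c * d by ring]
  ring

section

variable {q : ℂ} (hq : ‖q‖ < 1) (hq0 : q ≠ 0)

include hq

theorem qTheta_div_swap {u v : ℂ} (hu : u ≠ 0) (hv : v ≠ 0) :
    qTheta (u / v) q = -(u / v) * qTheta (v / u) q := by
  rw [← inv_div v u, qTheta_inv hq (div_ne_zero hv hu), inv_div]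

theorem thetaPair_swap {u v : ℂ} (hu : u ≠ 0) (hv : v ≠ 0) :
    thetaPair q u v = -(u / v) * thetaPair q v u := by
  rw [thetaPair, thetaPair, qTheta_div_swap hq hu hv, mul_comm u v]
  ring

theorem thetaPair_inv_left {u v : ℂ} (hu : u ≠ 0) (hv : v ≠ 0) :
    thetaPair q u⁻¹ v = -(u * v)⁻¹ * thetaPair q v u := by
  rw [thetaPair, thetaPair, show u⁻¹ * v = v / u by field_simp, show u⁻¹ / v = (v * u)⁻¹ by field_simp,
    qTheta_inv hq (mul_ne_zero hv hu), mul_comm u v]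
  ring

theorem thetaPair_self {u : ℂ} (hu : u ≠ 0) : thetaPair q u u = 0 := by
  rw [thetaPair, div_self hu, qTheta_one hq, mul_zero]

theorem thetaPair_inv_self {u : ℂ} (hu : u ≠ 0) : thetaPair q u⁻¹ u = 0 := by
  rw [thetaPair, inv_mul_cancel₀ hu, qTheta_one hq, zero_mul]

theorem differentiableAt_thetaPair {u v : ℂ} (hu : u ≠ 0) (hv : v ≠ 0) :
    DifferentiableAt ℂ (fun u => thetaPair q u v) u :=
  DifferentiableAt.mul
    (DifferentiableAt.comp (g := fun z => qTheta z q) (f := fun u => u * v) u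
      (differentiableAt_qTheta hq (mul_ne_zero hu hv)) (differentiableAt_id.mul_const v))
    (DifferentiableAt.comp (g := fun z => qTheta z q) (f := fun u => u / v) u
      (differentiableAt_qTheta hq (div_ne_zero hu hv)) (differentiableAt_id.div_const v))

theorem differentiableOn_thetaNumerator {b c d : ℂ} (hb : b ≠ 0) (hc : c ≠ 0) (hd : d ≠ 0) :
    DifferentiableOn ℂ (thetaNumerator q b c d) {0}ᶜ := by
  intro x hx
  have hx : x ≠ 0 := hx
  refine DifferentiableAt.differentiableWithinAt ?_
  have h1 : DifferentiableAt ℂ (fun x => qTheta ((x ^ 2)⁻¹) q) x :=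
    DifferentiableAt.comp (g := fun z => qTheta z q) (f := fun x => (x ^ 2)⁻¹) x
      (differentiableAt_qTheta hq (by simpa using hx))
      ((differentiableAt_pow 2).fun_inv (pow_ne_zero 2 hx))
  have h2 : DifferentiableAt ℂ (fun x => qTheta (x * b * c * d) q) x :=
    DifferentiableAt.comp (g := fun z => qTheta z q) (f := fun x => x * b * c * d) x
      (differentiableAt_qTheta hq (by simp [*])) (by fun_prop)
  have h3 : ∀ v, v ≠ 0 → DifferentiableAt ℂ (fun x => qTheta (x / v) q) x := fun v hv =>
    DifferentiableAt.comp (g := fun z => qTheta z q) (f := fun u => u / v) x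
      (differentiableAt_qTheta hq (div_ne_zero hx hv)) (differentiableAt_id.div_const v)
  have h3b := h3 b hb
  have h3c := h3 c hc
  have h3d := h3 d hd
  have h4b := differentiableAt_thetaPair hq hx hb
  have h4c := differentiableAt_thetaPair hq hx hc
  have h4d := differentiableAt_thetaPair hq hx hd
  unfold thetaNumerator
  fun_prop

include hq0

theorem thetaPair_mul_base {u v : ℂ} (hu : u ≠ 0) (hv : v ≠ 0) :
    thetaPair q (q * u) v = (u ^ 2)⁻¹ * thetaPair q u v := by
  rw [thetaPair, thetaPair, mul_assoc, mul_div_assoc, qTheta_mul_base hq hq0 (mul_ne_zero hu hv),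
    qTheta_mul_base hq hq0 (div_ne_zero hu hv)]
  field_simp

theorem thetaNumerator_mul_base {b c d x : ℂ} (hb : b ≠ 0) (hc : c ≠ 0) (hd : d ≠ 0) (hx : x ≠ 0) :
    thetaNumerator q b c d (q * x) = (x ^ 4)⁻¹ * thetaNumerator q b c d x := by
  have h1 : qTheta (((q * x) ^ 2)⁻¹) q = (q ^ 3)⁻¹ * (x ^ 4)⁻¹ * qTheta ((x ^ 2)⁻¹) q := by
    have ha := qTheta_mul_base hq hq0 (z := (q * x ^ 2)⁻¹) (by simp [*])
    have hb := qTheta_mul_base hq hq0 (z := ((q * x) ^ 2)⁻¹) (by simp [*])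
    rw [show q * (q * x ^ 2)⁻¹ = (x ^ 2)⁻¹ by field_simp] at ha
    rw [show q * ((q * x) ^ 2)⁻¹ = (q * x ^ 2)⁻¹ by field_simp] at hb
    rw [ha, hb]
    field_simp
  have h2 : qTheta (q * x * b * c * d) q = -(x * b * c * d)⁻¹ * qTheta (x * b * c * d) q := by
    rw [← qTheta_mul_base hq hq0 (by simp [*])]
    congr 1
    ring
  have h3 : ∀ v, v ≠ 0 → qTheta (q * x / v) q = -(v / x) * qTheta (x / v) q := fun v hv => by
    rw [mul_div_assoc, qTheta_mul_base hq hq0 (div_ne_zero hx hv), inv_div]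
  rw [thetaNumerator, thetaNumerator, h1, h2, h3 b hb, h3 c hc, h3 d hd,
    thetaPair_mul_base hq hq0 hx hb, thetaPair_mul_base hq hq0 hx hc,
    thetaPair_mul_base hq hq0 hx hd]
  have e1 : (q * x) ^ 3 / (b * c * d) * ((q ^ 3)⁻¹ * (x ^ 4)⁻¹) = (x ^ 4)⁻¹ * (x ^ 3 / (b * c * d)) := by
    field_simp
  have e2 : (x ^ 2)⁻¹ * (x ^ 2)⁻¹ = (x ^ 4)⁻¹ := by rw [← mul_inv, ← pow_add]
  have e3 : (x * b * c * d)⁻¹ * ((b / x) * (c / x) * (d / x)) = (x ^ 4)⁻¹ := by field_simp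
  rw [← e2] at e1 e3 ⊢
  linear_combination (-qTheta ((x ^ 2)⁻¹) q) * e1 -
    2 * (qTheta (x * b * c * d) q * (qTheta (x / b) q * qTheta (x / c) q * qTheta (x / d) q) /
      (qTheta (b * c) q * qTheta (b * d) q * qTheta (c * d) q)) * e3

theorem thetaNumerator_zpow_mul_eq_zero {b c d x : ℂ} (hb : b ≠ 0) (hc : c ≠ 0) (hd : d ≠ 0)
    (hx : x ≠ 0) (h : thetaNumerator q b c d x = 0) (m : ℤ) :
    thetaNumerator q b c d (q ^ m * x) = 0 := by
  have hiff : ∀ m : ℤ, thetaNumerator q b c d (q ^ (m + 1) * x) = 0 ↔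
      thetaNumerator q b c d (q ^ m * x) = 0 := fun m => by
    have hne : q ^ m * x ≠ 0 := mul_ne_zero (zpow_ne_zero m hq0) hx
    rw [zpow_add_one₀ hq0, mul_comm (q ^ m) q, mul_assoc,
      thetaNumerator_mul_base hq hq0 hb hc hd hne, mul_eq_zero, inv_eq_zero, pow_eq_zero_iff four_ne_zero]
    exact or_iff_right hne
  induction m using Int.induction_on with
  | zero => simpa using h
  | succ n ih => exact (hiff n).2 ih
  | pred n ih =>
    have := hiff (-n - 1)
    rw [sub_add_cancel] at this
    exact this.1 ih

/-- A zero of θ(xb)θ(x/b) is x = qᵐb or x = qᵐb⁻¹, and quasi-periodicity reduces both to m = 0. At x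
= b only the first two terms survive, and they cancel. At x = b⁻¹ these two terms are equal, and
together they match the product term; this is where the factor 2 of the identity comes from. -/
theorem thetaNumerator_eq_zero_of_thetaPair {b c d x : ℂ} (hb : b ≠ 0) (hc : c ≠ 0) (hd : d ≠ 0)
    (hx : x ≠ 0) (hbc : thetaPair q b c ≠ 0) (hbd : thetaPair q b d ≠ 0) (hcd : thetaPair q c d ≠ 0)
    (h : thetaPair q x b = 0) : thetaNumerator q b c d x = 0 := by
  have hb' : b⁻¹ ≠ 0 := inv_ne_zero hb
  have h1 : thetaNumerator q b c d b = 0 := by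
    rw [thetaNumerator, thetaPair_self hq hb, thetaPair_swap hq hc hb, thetaPair_swap hq hd hb,
      div_self hb, qTheta_one hq]
    field_simp
    ring
  have h2 : thetaNumerator q b c d b⁻¹ = 0 := by
    have hcb : thetaPair q c b ≠ 0 := by
      rw [thetaPair_swap hq hc hb]
      exact mul_ne_zero (neg_ne_zero.2 (div_ne_zero hc hb)) hbc
    have hdb : thetaPair q d b ≠ 0 := by
      rw [thetaPair_swap hq hd hb]
      exact mul_ne_zero (neg_ne_zero.2 (div_ne_zero hd hb)) hbd
    have e1 : qTheta ((b⁻¹ ^ 2)⁻¹) q = -b ^ 2 * qTheta ((b ^ 2)⁻¹) q := by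
      rw [inv_pow, qTheta_inv hq (inv_ne_zero (pow_ne_zero 2 hb)), inv_inv]
    have e2 : ∀ v, v ≠ 0 → qTheta (b⁻¹ / v) q = -(b * v)⁻¹ * qTheta (b * v) q := fun v hv => by
      rw [show b⁻¹ / v = (b * v)⁻¹ by field_simp, qTheta_inv hq (mul_ne_zero hb hv)]
    have e3 : qTheta (b⁻¹ / b) q = qTheta ((b ^ 2)⁻¹) q := by congr 1; field_simp
    rw [thetaNumerator, thetaPair_inv_self hq hb, thetaPair_inv_left hq hb hc,
      thetaPair_inv_left hq hb hd, e1, e2 c hc, e2 d hd, e3, inv_mul_cancel₀ hb, one_mul]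
    have f1 : qTheta (b * c) q ≠ 0 := left_ne_zero_of_mul hbc
    have f2 : qTheta (b * d) q ≠ 0 := left_ne_zero_of_mul hbd
    have f3 : qTheta (c * d) q ≠ 0 := left_ne_zero_of_mul hcd
    field_simp
    ring
  rcases mul_eq_zero.1 h with h | h
  · obtain ⟨m, hm⟩ := (qTheta_eq_zero_iff hq hq0 (mul_ne_zero hx hb)).1 h
    rw [show x = q ^ m * b⁻¹ by rw [← hm]; field_simp]
    exact thetaNumerator_zpow_mul_eq_zero hq hq0 hb hc hd hb' h2 m
  · obtain ⟨m, hm⟩ := (qTheta_eq_zero_iff hq hq0 (div_ne_zero hx hb)).1 h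
    rw [show x = q ^ m * b by rw [← hm]; field_simp]
    exact thetaNumerator_zpow_mul_eq_zero hq hq0 hb hc hd hb h1 m

/-- If both pairs vanished, x would lie in q^ℤb^{±1} and in q^ℤc^{±1}, which puts bc, b/c or c/b in
q^ℤ. -/
theorem thetaPair_ne_zero_of_eq_zero {b c x : ℂ} (hb : b ≠ 0) (hc : c ≠ 0) (hx : x ≠ 0)
    (hbc : thetaPair q b c ≠ 0) (h : thetaPair q x b = 0) : thetaPair q x c ≠ 0 := by
  intro h'
  have hxb := mul_ne_zero hx hb
  have hxc := mul_ne_zero hx hc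
  have hxb' := div_ne_zero hx hb
  have hxc' := div_ne_zero hx hc
  have h1 : qTheta (b * c) q ≠ 0 := left_ne_zero_of_mul hbc
  have h2 : qTheta (b / c) q ≠ 0 := right_ne_zero_of_mul hbc
  have h3 : qTheta (c / b) q ≠ 0 := by
    rw [qTheta_div_swap hq hb hc] at h2
    exact right_ne_zero_of_mul h2
  rcases mul_eq_zero.1 h with h | h <;> rcases mul_eq_zero.1 h' with h' | h'
  · exact h2 (by convert qTheta_div_eq_zero hq hq0 hxb hxc h h' using 2; field_simp)
  · exact h1 (by convert qTheta_div_eq_zero hq hq0 hxb hxc' h h' using 2; field_simp)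
  · exact h1 (by convert qTheta_div_eq_zero hq hq0 hxc hxb' h' h using 2; field_simp)
  · exact h3 (by convert qTheta_div_eq_zero hq hq0 hxb' hxc' h h' using 2; field_simp)

/-- The two theta factors have simple zeros and cannot vanish together, since then b² = (xb)/(x/b)
would lie in q^ℤ. -/
theorem deriv_thetaPair_ne_zero {b x : ℂ} (hb : b ≠ 0) (hx : x ≠ 0) (hb2 : qTheta (b ^ 2) q ≠ 0)
    (h : thetaPair q x b = 0) : deriv (fun x => thetaPair q x b) x ≠ 0 := by
  have hxb := mul_ne_zero hx hb
  have hxb' := div_ne_zero hx hb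
  have d1 : HasDerivAt (fun x => qTheta (x * b) q) (deriv (fun z => qTheta z q) (x * b) * b) x :=
    HasDerivAt.comp (h₂ := fun z => qTheta z q) (h := fun x => x * b) x
      (differentiableAt_qTheta hq hxb).hasDerivAt (by simpa using (hasDerivAt_id x).mul_const b)
  have d2 : HasDerivAt (fun x => qTheta (x / b) q) (deriv (fun z => qTheta z q) (x / b) * (1 / b)) x :=
    HasDerivAt.comp (h₂ := fun z => qTheta z q) (h := fun x => x / b) x
      (differentiableAt_qTheta hq hxb').hasDerivAt (by simpa using (hasDerivAt_id x).div_const b)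
  have hboth : qTheta (x * b) q = 0 → qTheta (x / b) q = 0 → False := fun h1 h2 =>
    hb2 (by convert qTheta_div_eq_zero hq hq0 hxb hxb' h1 h2 using 2; field_simp)
  rw [show (fun x => thetaPair q x b) = fun x => qTheta (x * b) q * qTheta (x / b) q from rfl,
    (d1.fun_mul d2).deriv]
  rcases mul_eq_zero.1 h with h | h
  · rw [h, zero_mul, add_zero]
    exact mul_ne_zero (mul_ne_zero (deriv_qTheta_ne_zero hq hq0 hxb h) hb) (hboth h)
  · rw [h, mul_zero, zero_add]
    exact mul_ne_zero (fun h' => hboth h' h)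
      (mul_ne_zero (deriv_qTheta_ne_zero hq hq0 hxb' h) (one_div_ne_zero hb))

theorem deriv_thetaPair_mul_ne_zero {b x : ℂ} {R : ℂ → ℂ} (hb : b ≠ 0) (hx : x ≠ 0)
    (hb2 : qTheta (b ^ 2) q ≠ 0) (h : thetaPair q x b = 0) (hR : R x ≠ 0)
    (hRd : DifferentiableAt ℂ R x) : deriv (fun x => thetaPair q x b * R x) x ≠ 0 := by
  rw [((differentiableAt_thetaPair hq hx hb).hasDerivAt.fun_mul hRd.hasDerivAt).deriv, h, zero_mul,
    add_zero]
  exact mul_ne_zero (deriv_thetaPair_ne_zero hq hq0 hb hx hb2 h) hR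

theorem thetaNumerator_eq_zero {b c d x : ℂ} (hb : b ≠ 0) (hc : c ≠ 0) (hd : d ≠ 0) (hx : x ≠ 0)
    (hbc : thetaPair q b c ≠ 0) (hbd : thetaPair q b d ≠ 0) (hcd : thetaPair q c d ≠ 0)
    (hb2 : qTheta (b ^ 2) q ≠ 0) (hc2 : qTheta (c ^ 2) q ≠ 0) (hd2 : qTheta (d ^ 2) q ≠ 0)
    (hxb : thetaPair q x b ≠ 0) (hxc : thetaPair q x c ≠ 0) (hxd : thetaPair q x d ≠ 0) :
    thetaNumerator q b c d x = 0 := by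
  have swap : ∀ {u v : ℂ}, u ≠ 0 → v ≠ 0 → thetaPair q u v ≠ 0 → thetaPair q v u ≠ 0 := by
    intro u v hu hv h
    rw [thetaPair_swap hq hu hv] at h
    exact right_ne_zero_of_mul h
  have hcb := swap hb hc hbc
  have hdb := swap hb hd hbd
  have hdc := swap hc hd hcd
  refine eq_zero_of_theta_quotient hq hq0
    (P := fun x => thetaPair q x b * (thetaPair q x c * thetaPair q x d))
    (differentiableOn_thetaNumerator hq hb hc hd) ?_ ?_
    (fun z hz => thetaNumerator_mul_base hq hq0 hb hc hd hz) ?_ hx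
    (mul_ne_zero hxb (mul_ne_zero hxc hxd))
  · intro z hz
    exact ((differentiableAt_thetaPair hq hz hb).mul ((differentiableAt_thetaPair hq hz hc).mul
      (differentiableAt_thetaPair hq hz hd))).differentiableWithinAt
  · intro z hz h
    have db := differentiableAt_thetaPair hq hz hb
    have dc := differentiableAt_thetaPair hq hz hc
    have dd := differentiableAt_thetaPair hq hz hd
    rcases mul_eq_zero.1 h with h | h
    · refine ⟨thetaNumerator_eq_zero_of_thetaPair hq hq0 hb hc hd hz hbc hbd hcd h, ?_⟩
      exact deriv_thetaPair_mul_ne_zero hq hq0 hb hz hb2 h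
        (mul_ne_zero (thetaPair_ne_zero_of_eq_zero hq hq0 hb hc hz hbc h)
          (thetaPair_ne_zero_of_eq_zero hq hq0 hb hd hz hbd h)) (dc.fun_mul dd)
    rcases mul_eq_zero.1 h with h | h
    -- The numerator is invariant under cyclic rotation of b, c, d, so the zeros belonging to c and
    -- d reduce to those belonging to b.
    · refine ⟨?_, ?_⟩
      · rw [thetaNumerator_rotate]
        exact thetaNumerator_eq_zero_of_thetaPair hq hq0 hc hd hb hz hcd hcb hdb h
      · refine Eq.trans_ne (congrArg (fun F => deriv F z) (funext fun x => mul_left_comm _ _ _))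
          (deriv_thetaPair_mul_ne_zero (R := fun x => thetaPair q x b * thetaPair q x d)
            hq hq0 hc hz hc2 h ?_ (db.fun_mul dd))
        exact (mul_ne_zero (thetaPair_ne_zero_of_eq_zero hq hq0 hc hb hz hcb h)
            (thetaPair_ne_zero_of_eq_zero hq hq0 hc hd hz hcd h))
    · refine ⟨?_, ?_⟩
      · rw [thetaNumerator_rotate, thetaNumerator_rotate]
        exact thetaNumerator_eq_zero_of_thetaPair hq hq0 hd hb hc hz hdb hdc hbc h
      · refine Eq.trans_ne (congrArg (fun F => deriv F z) (funext fun x => ?_))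
          (deriv_thetaPair_mul_ne_zero (R := fun x => thetaPair q x b * thetaPair q x c)
            hq hq0 hd hz hd2 h ?_ (db.fun_mul dc))
        · ring
        exact (mul_ne_zero (thetaPair_ne_zero_of_eq_zero hq hq0 hd hb hz hdb h)
            (thetaPair_ne_zero_of_eq_zero hq hq0 hd hc hz hdc h))
  · intro z hz
    simp only [thetaPair_mul_base hq hq0 hz hb, thetaPair_mul_base hq hq0 hz hc,
      thetaPair_mul_base hq hq0 hz hd]
    field_simp

end

theorem theta_identity_of_sq_ne_zero {q : ℂ} (hq : ‖q‖ < 1) (hq0 : q ≠ 0) (x : Fin 4 → ℂ)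
    (hx : ∀ k, x k ≠ 0)
    (h : ∀ i k, i ≠ k → qTheta (x i * x k) q ≠ 0 ∧ qTheta (x i / x k) q ≠ 0)
    (h2 : ∀ k, qTheta (x k ^ 2) q ≠ 0) :
    ∑ k, qTheta ((x k ^ 2)⁻¹) q /
        ∏ i ∈ Finset.univ.erase k, (qTheta (x i * x k) q * qTheta (x i / x k) q) =
      2 * (qTheta (∏ k, x k) q / ∏ i, ∏ j ∈ Finset.Ioi i, qTheta (x i * x j) q) := by
  have hp : ∀ i k, i ≠ k → thetaPair q (x i) (x k) ≠ 0 := fun i k hik =>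
    mul_ne_zero (h i k hik).1 (h i k hik).2
  have key := thetaNumerator_eq_zero hq hq0 (hx 1) (hx 2) (hx 3) (hx 0)
    (hp 1 2 (by decide)) (hp 1 3 (by decide)) (hp 2 3 (by decide)) (h2 1) (h2 2) (h2 3)
    (hp 0 1 (by decide)) (hp 0 2 (by decide)) (hp 0 3 (by decide))
  have e0 : Finset.univ.erase (0 : Fin 4) = {1, 2, 3} := by decide
  have e1 : Finset.univ.erase (1 : Fin 4) = {0, 2, 3} := by decide
  have e2 : Finset.univ.erase (2 : Fin 4) = {0, 1, 3} := by decide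
  have e3 : Finset.univ.erase (3 : Fin 4) = {0, 1, 2} := by decide
  have i0 : Finset.Ioi (0 : Fin 4) = {1, 2, 3} := by decide
  have i1 : Finset.Ioi (1 : Fin 4) = {2, 3} := by decide
  have i2 : Finset.Ioi (2 : Fin 4) = {3} := by decide
  have i3 : Finset.Ioi (3 : Fin 4) = ∅ := by decide
  have hL : ∀ k, ∀ s : Finset (Fin 4), ∏ i ∈ s, (qTheta (x i * x k) q * qTheta (x i / x k) q) =
    ∏ i ∈ s, thetaPair q (x i) (x k) := fun _ _ => rfl
  have p01 := hp 0 1 (by decide)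
  have p02 := hp 0 2 (by decide)
  have p03 := hp 0 3 (by decide)
  have p12 := hp 1 2 (by decide)
  have p13 := hp 1 3 (by decide)
  have p23 := hp 2 3 (by decide)
  have p21 := hp 2 1 (by decide)
  have p31 := hp 3 1 (by decide)
  have p32 := hp 3 2 (by decide)
  have s0 : ∀ k : Fin 4, thetaPair q (x k) (x 0) = -(x k / x 0) * thetaPair q (x 0) (x k) :=
    fun k => thetaPair_swap hq (hx k) (hx 0)
  have hx0 := hx 0
  have hx1 := hx 1
  have hx2 := hx 2
  have hx3 := hx 3
  have hR : 2 * (qTheta (x 0 * x 1 * x 2 * x 3) q *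
      (qTheta (x 0 / x 1) q * qTheta (x 0 / x 2) q * qTheta (x 0 / x 3) q) /
      (qTheta (x 1 * x 2) q * qTheta (x 1 * x 3) q * qTheta (x 2 * x 3) q)) =
      2 * (qTheta (∏ k, x k) q / ∏ i, ∏ j ∈ Finset.Ioi i, qTheta (x i * x j) q) *
      (thetaPair q (x 0) (x 1) * thetaPair q (x 0) (x 2) * thetaPair q (x 0) (x 3)) := by
    have a01 := (h 0 1 (by decide)).1
    have a02 := (h 0 2 (by decide)).1
    have a03 := (h 0 3 (by decide)).1
    have a12 := (h 1 2 (by decide)).1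
    have a13 := (h 1 3 (by decide)).1
    have a23 := (h 2 3 (by decide)).1
    simp only [Fin.prod_univ_four, i0, i1, i2, i3, Finset.prod_empty, Finset.prod_singleton]
    rw [Finset.prod_insert (by decide), Finset.prod_insert (by decide),
      Finset.prod_insert (by decide), Finset.prod_singleton, Finset.prod_singleton]
    simp only [thetaPair]
    field_simp
  refine mul_right_cancel₀ (mul_ne_zero (mul_ne_zero p01 p02) p03) ?_
  rw [← hR]
  rw [thetaNumerator, sub_eq_zero] at key
  rw [← key, Fin.sum_univ_four]
  simp only [hL, e0, e1, e2, e3]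
  rw [Finset.prod_insert (by decide), Finset.prod_insert (by decide), Finset.prod_singleton,
    Finset.prod_insert (by decide), Finset.prod_insert (by decide), Finset.prod_singleton,
    Finset.prod_insert (by decide), Finset.prod_insert (by decide), Finset.prod_singleton,
    Finset.prod_insert (by decide), Finset.prod_insert (by decide), Finset.prod_singleton,
    s0, s0, s0]
  field_simp
  ring

/-- Both the points and the base may move, so that the same statement serves for perturbing x and
for letting the base tend to 0. -/
theorem tendsto_theta_identity {α : Type*} {l : Filter α} {Q : α → ℂ} {X : α → Fin 4 → ℂ} {q : ℂ}
    (hq : ‖q‖ < 1) {x : Fin 4 → ℂ} (hx : ∀ k, x k ≠ 0)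
    (h : ∀ i k, i ≠ k → qTheta (x i * x k) q ≠ 0 ∧ qTheta (x i / x k) q ≠ 0)
    (hQ : Tendsto Q l (𝓝 q)) (hX : ∀ k, Tendsto (fun t => X t k) l (𝓝 (x k))) :
    Tendsto (fun t => ∑ k, qTheta ((X t k ^ 2)⁻¹) (Q t) /
        ∏ i ∈ Finset.univ.erase k, (qTheta (X t i * X t k) (Q t) * qTheta (X t i / X t k) (Q t)) -
      2 * (qTheta (∏ k, X t k) (Q t) / ∏ i, ∏ j ∈ Finset.Ioi i, qTheta (X t i * X t j) (Q t))) l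
      (𝓝 (∑ k, qTheta ((x k ^ 2)⁻¹) q /
        ∏ i ∈ Finset.univ.erase k, (qTheta (x i * x k) q * qTheta (x i / x k) q) -
      2 * (qTheta (∏ k, x k) q / ∏ i, ∏ j ∈ Finset.Ioi i, qTheta (x i * x j) q))) := by
  have hmul : ∀ i k, Tendsto (fun t => qTheta (X t i * X t k) (Q t)) l (𝓝 (qTheta (x i * x k) q)) :=
    fun i k => tendsto_qTheta hq (mul_ne_zero (hx i) (hx k)) ((hX i).mul (hX k)) hQ
  have hdiv : ∀ i k, Tendsto (fun t => qTheta (X t i / X t k) (Q t)) l (𝓝 (qTheta (x i / x k) q)) :=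
    fun i k => tendsto_qTheta hq (div_ne_zero (hx i) (hx k)) ((hX i).div (hX k) (hx k)) hQ
  refine Tendsto.sub (tendsto_finsetSum _ fun k _ => Tendsto.div ?_ ?_ ?_)
    (Tendsto.const_mul 2 (Tendsto.div ?_ ?_ ?_))
  · exact tendsto_qTheta hq (inv_ne_zero (pow_ne_zero 2 (hx k)))
      (((hX k).pow 2).inv₀ (pow_ne_zero 2 (hx k))) hQ
  · exact tendsto_finsetProd _ fun i _ => (hmul i k).mul (hdiv i k)
  · exact Finset.prod_ne_zero_iff.2 fun i hi =>
      mul_ne_zero (h i k (Finset.ne_of_mem_erase hi)).1 (h i k (Finset.ne_of_mem_erase hi)).2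
  · exact tendsto_qTheta hq (Finset.prod_ne_zero_iff.2 fun k _ => hx k)
      (tendsto_finsetProd _ fun k _ => hX k) hQ
  · exact tendsto_finsetProd _ fun i _ => tendsto_finsetProd _ fun j _ => hmul i j
  · exact Finset.prod_ne_zero_iff.2 fun i _ => Finset.prod_ne_zero_iff.2 fun j hj =>
      (h i j (Finset.mem_Ioi.1 hj).ne).1

theorem eventually_theta_hypotheses {α : Type*} {l : Filter α} {Q : α → ℂ} {X : α → Fin 4 → ℂ}
    {q : ℂ} (hq : ‖q‖ < 1) {x : Fin 4 → ℂ} (hx : ∀ k, x k ≠ 0)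
    (h : ∀ i k, i ≠ k → qTheta (x i * x k) q ≠ 0 ∧ qTheta (x i / x k) q ≠ 0)
    (hQ : Tendsto Q l (𝓝 q)) (hX : ∀ k, Tendsto (fun t => X t k) l (𝓝 (x k))) :
    ∀ᶠ t in l, ∀ i k, i ≠ k →
      qTheta (X t i * X t k) (Q t) ≠ 0 ∧ qTheta (X t i / X t k) (Q t) ≠ 0 := by
  refine eventually_all.2 fun i => eventually_all.2 fun k => ?_
  by_cases hik : i = k
  · exact Eventually.of_forall fun t h => absurd hik h
  filter_upwards [(tendsto_qTheta hq (mul_ne_zero (hx i) (hx k)) ((hX i).mul (hX k)) hQ).eventually_ne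
    (h i k hik).1, (tendsto_qTheta hq (div_ne_zero (hx i) (hx k))
    ((hX i).div (hX k) (hx k)) hQ).eventually_ne (h i k hik).2] with t h1 h2 _ using ⟨h1, h2⟩

theorem theta_identity_of_ne_zero {q : ℂ} (hq : ‖q‖ < 1) (hq0 : q ≠ 0) (x : Fin 4 → ℂ)
    (hx : ∀ k, x k ≠ 0)
    (h : ∀ i k, i ≠ k → qTheta (x i * x k) q ≠ 0 ∧ qTheta (x i / x k) q ≠ 0) :
    ∑ k, qTheta ((x k ^ 2)⁻¹) q /
        ∏ i ∈ Finset.univ.erase k, (qTheta (x i * x k) q * qTheta (x i / x k) q) =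
      2 * (qTheta (∏ k, x k) q / ∏ i, ∏ j ∈ Finset.Ioi i, qTheta (x i * x j) q) := by
  -- All four points are scaled by a common t near 1. Since zeros of θ are isolated, this makes
  -- every θ((x_k t)²) nonzero for t ≠ 1.
  have hX : ∀ k, Tendsto (fun t : ℂ => x k * t) (𝓝[≠] 1) (𝓝 (x k)) := fun k => by
    have : ContinuousAt (fun t : ℂ => x k * t) 1 := by fun_prop
    simpa using this.tendsto.mono_left nhdsWithin_le_nhds
  have hsq : ∀ᶠ t in 𝓝[≠] (1 : ℂ), ∀ k, qTheta ((x k * t) ^ 2) q ≠ 0 := by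
    refine eventually_all.2 fun k => ?_
    have hk2 := pow_ne_zero 2 (hx k)
    have hd : HasDerivAt (fun t : ℂ => qTheta ((x k * t) ^ 2) q)
        (deriv (fun z => qTheta z q) ((x k * 1) ^ 2) * (2 * x k ^ 2)) 1 := by
      refine HasDerivAt.comp (h₂ := fun z => qTheta z q) (h := fun t : ℂ => (x k * t) ^ 2) (1 : ℂ)
        (differentiableAt_qTheta hq (by simpa using hk2)).hasDerivAt ?_
      convert! ((hasDerivAt_id (1 : ℂ)).const_mul (x k)).fun_pow 2 using 1
      simp
      ring
    by_cases h0 : qTheta (x k ^ 2) q = 0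
    · refine hd.eventually_ne (mul_ne_zero ?_ (mul_ne_zero two_ne_zero hk2))
      rw [mul_one]
      exact deriv_qTheta_ne_zero hq hq0 hk2 h0
    · exact (hd.continuousAt.eventually_ne (by simpa using h0)).filter_mono nhdsWithin_le_nhds
  have ht0 : ∀ᶠ t in 𝓝[≠] (1 : ℂ), t ≠ 0 :=
    (continuousAt_id.eventually_ne one_ne_zero).filter_mono nhdsWithin_le_nhds
  refine sub_eq_zero.1 (tendsto_nhds_unique_of_eventuallyEq
    (tendsto_theta_identity hq hx h tendsto_const_nhds hX) tendsto_const_nhds ?_)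
  filter_upwards [hsq, ht0, eventually_theta_hypotheses hq hx h tendsto_const_nhds hX]
    with t h1 h2 h3
  exact sub_eq_zero.2 (theta_identity_of_sq_ne_zero hq hq0 _ (fun k => mul_ne_zero (hx k) h2) h3 h1)

theorem theta_identity {q : ℂ} (hq : ‖q‖ < 1) (x : Fin 4 → ℂ) (hx : ∀ k, x k ≠ 0)
    (h : ∀ i k, i ≠ k → qTheta (x i * x k) q ≠ 0 ∧ qTheta (x i / x k) q ≠ 0) :
    ∑ k, qTheta ((x k ^ 2)⁻¹) q /
        ∏ i ∈ Finset.univ.erase k, (qTheta (x i * x k) q * qTheta (x i / x k) q) =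
      2 * (qTheta (∏ k, x k) q / ∏ i, ∏ j ∈ Finset.Ioi i, qTheta (x i * x j) q) := by
  have hQ : Tendsto (fun p : ℂ => p) (𝓝[≠] q) (𝓝 q) := tendsto_id.mono_left nhdsWithin_le_nhds
  have hX : ∀ k, Tendsto (fun _ : ℂ => x k) (𝓝[≠] q) (𝓝 (x k)) := fun k => tendsto_const_nhds
  rcases ne_or_eq q 0 with hq0 | rfl
  · exact theta_identity_of_ne_zero hq hq0 x hx h
  refine sub_eq_zero.1 (tendsto_nhds_unique_of_eventuallyEq
    (tendsto_theta_identity hq hx h hQ hX) tendsto_const_nhds ?_)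
  filter_upwards [self_mem_nhdsWithin, hQ.norm.eventually_lt_const hq,
    eventually_theta_hypotheses hq hx h hQ hX] with p h1 h2 h3
  exact sub_eq_zero.2 (theta_identity_of_ne_zero h2 h1 x hx h3)

/-! ### Bounds for finite q-products -/

theorem tendsto_qPoch {q : ℂ} (hq : ‖q‖ < 1) (a : ℂ) :
    Tendsto (fun n => qPoch a q n) atTop (𝓝 (qPochInf a q)) :=
  (multipliable_qPochInf hq a).hasProd.tendsto_prod_nat

theorem exists_norm_le_of_tendsto {f : ℕ → ℂ} {z : ℂ} (h : Tendsto f atTop (𝓝 z)) :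
    ∃ C, 0 < C ∧ ∀ n, ‖f n‖ ≤ C := by
  obtain ⟨C, hC⟩ := h.norm.bddAbove_range
  exact ⟨max C 1, by positivity, fun n => (hC ⟨n, rfl⟩).trans (le_max_left _ _)⟩

theorem exists_norm_qPoch_le {q : ℂ} (hq : ‖q‖ < 1) (a : ℂ) :
    ∃ C, 0 < C ∧ ∀ n, ‖qPoch a q n‖ ≤ C :=
  exists_norm_le_of_tendsto (tendsto_qPoch hq a)

theorem exists_norm_inv_qPoch_le {q : ℂ} (hq : ‖q‖ < 1) {a : ℂ} (ha : ∀ k : ℕ, a * q ^ k ≠ 1) :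
    ∃ C, 0 < C ∧ ∀ n, ‖(qPoch a q n)⁻¹‖ ≤ C :=
  exists_norm_le_of_tendsto ((tendsto_qPoch hq a).inv₀ fun h =>
    let ⟨k, hk⟩ := (qPochInf_eq_zero_iff hq a).1 h
    ha k hk)

theorem qPoch_add (a q : ℂ) (m n : ℕ) :
    qPoch a q (m + n) = qPoch a q m * qPoch (a * q ^ m) q n := by
  simp only [qPoch, Finset.prod_range_add, pow_add, mul_assoc]

theorem qPoch_succ' (a q : ℂ) (n : ℕ) : qPoch a q (n + 1) = (1 - a) * qPoch (a * q) q n := by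
  rw [add_comm, qPoch_add]
  simp [qPoch]

/-- The product `∏_{k<n} (t - q^k)`, which is `d⁻ⁿ (d;q)_n` for `t = d⁻¹`. -/
noncomputable def qFalling (t q : ℂ) (n : ℕ) : ℂ := ∏ k ∈ Finset.range n, (t - q ^ k)

theorem qFalling_succ (t q : ℂ) (n : ℕ) : qFalling t q (n + 1) = qFalling t q n * (t - q ^ n) := by
  simp [qFalling, Finset.prod_range_succ]

theorem qFalling_mul_base_succ (t q : ℂ) (n : ℕ) :
    qFalling (q * t) q (n + 1) = (q * t - 1) * (q ^ n * qFalling t q n) := by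
  have : ∀ k, q * t - q ^ (k + 1) = q * (t - q ^ k) := fun k => by ring
  simp only [qFalling, Finset.prod_range_succ', pow_zero, this, Finset.prod_mul_distrib,
    Finset.prod_const, Finset.card_range]
  ring

theorem qFalling_one_succ (q : ℂ) (n : ℕ) : qFalling 1 q (n + 1) = 0 := by
  simp [qFalling, Finset.prod_range_succ']

theorem qPoch_mul_inv_pow {d : ℂ} (hd : d ≠ 0) (q : ℂ) (n : ℕ) :
    qPoch d q n * d⁻¹ ^ n = qFalling d⁻¹ q n := by
  have : ∀ k, d⁻¹ - q ^ k = (1 - d * q ^ k) * d⁻¹ := fun k => by field_simp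
  simp only [qPoch, qFalling, this, Finset.prod_mul_distrib, Finset.prod_const, Finset.card_range]

/-- Factorwise ‖t − qᵏ‖ ≤ ρ(1 + ‖q‖ᵏ/ρ), so the product is at most ρⁿ(−1/ρ; ‖q‖)_n, and the last
symbol is bounded in n. Uniformity over ‖t‖ ≤ ρ supplies the domination needed as t → 0. -/
theorem exists_norm_qFalling_le {q : ℂ} (hq : ‖q‖ < 1) {ρ : ℝ} (hρ : 0 < ρ) :
    ∃ C, 0 < C ∧ ∀ t : ℂ, ‖t‖ ≤ ρ → ∀ n, ‖qFalling t q n‖ ≤ C * ρ ^ n := by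
  obtain ⟨C, hC0, hC⟩ := exists_norm_qPoch_le (q := (‖q‖ : ℂ)) (by simpa using hq) (-(1 / ρ : ℝ) : ℂ)
  refine ⟨C, hC0, fun t ht n => ?_⟩
  refine le_trans ?_ (mul_le_mul_of_nonneg_right (hC n) (pow_nonneg hρ.le n))
  rw [qFalling, qPoch, norm_prod, norm_prod]
  calc ∏ k ∈ Finset.range n, ‖t - q ^ k‖
      ≤ ∏ k ∈ Finset.range n, ‖1 - (-(1 / ρ : ℝ) : ℂ) * (‖q‖ : ℂ) ^ k‖ * ρ := by
        refine Finset.prod_le_prod (fun _ _ => norm_nonneg _) fun k _ => ?_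
        have : (1 - (-(1 / ρ : ℝ) : ℂ) * (‖q‖ : ℂ) ^ k) = ((1 + 1 / ρ * ‖q‖ ^ k : ℝ) : ℂ) := by
          push_cast; ring
        rw [this, Complex.norm_of_nonneg (by positivity)]
        calc ‖t - q ^ k‖ ≤ ‖t‖ + ‖q ^ k‖ := norm_sub_le _ _
          _ ≤ ρ + ‖q‖ ^ k := by rw [norm_pow]; gcongr
          _ = _ := by field_simp
    _ = _ := by rw [Finset.prod_mul_distrib, Finset.prod_const, Finset.card_range]

/-! ### The very-well-poised ₆φ₅ sum -/

/-- The general term of the very-well-poised `₆φ₅` series with parameters `a; b, c, t⁻¹`. -/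
noncomputable def vwpTerm (a b c q t : ℂ) (n : ℕ) : ℂ :=
  (1 - a * q ^ (2 * n)) / (1 - a) * (qPoch a q n * qPoch b q n * qPoch c q n * qFalling t q n) /
    (qPoch q q n * qPoch (a * q / b) q n * qPoch (a * q / c) q n * qPoch (a * q * t) q n) *
    (a * q / (b * c)) ^ n

/-- The partial sums of the contiguous relation between the series at `t` and at `q t`. -/
noncomputable def vwpPartial (a b c q t : ℂ) (n : ℕ) : ℂ :=
  a * q * t / (b * c) * (1 - b * q ^ n) * (1 - c * q ^ n) *
    (qPoch (a * q) q n * qPoch b q n * qPoch c q n * qFalling t q n) /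
    (qPoch q q n * qPoch (a * q / b) q n * qPoch (a * q / c) q n * qPoch (a * q * (q * t)) q n) *
    (a * q / (b * c)) ^ n

section

variable {a b c q t : ℂ} (hq : ‖q‖ < 1) (ha : ∀ k : ℕ, a * q ^ k ≠ 1)
  (hb : b ≠ 0) (hc : c ≠ 0) (hab : ∀ k : ℕ, a * q / b * q ^ k ≠ 1)
  (hac : ∀ k : ℕ, a * q / c * q ^ k ≠ 1) (hat : ∀ k : ℕ, a * q * t * q ^ k ≠ 1)

include hq

theorem base_mul_pow_ne_one (k : ℕ) : q * q ^ k ≠ 1 := by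
  intro h
  have h1 : ‖q‖ ^ (k + 1) = 1 := by rw [← norm_pow, pow_succ', h, norm_one]
  exact (pow_lt_one₀ (norm_nonneg q) hq k.succ_ne_zero).ne h1

include ha hb hc hab hac hat

/-- The contiguous combination telescopes, with `vwpPartial` as its closed-form partial sum. The
induction step is a rational identity in u = q^N once every product is expressed through its value
at N. -/
theorem sum_vwpTerm_sub (N : ℕ) :
    ∑ n ∈ Finset.range (N + 1),
      ((1 - a * q * t / b) * (1 - a * q * t / c) * vwpTerm a b c q (q * t) n -
        (1 - a * q * t) * (1 - a * q * t / (b * c)) * vwpTerm a b c q t n) =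
      vwpPartial a b c q t N := by
  have h1a : 1 - a ≠ 0 := fun h => ha 0 (by linear_combination -h)
  induction N with
  | zero =>
    simp [vwpTerm, vwpPartial, qPoch, qFalling, h1a]
    field_simp
    ring
  | succ N ih =>
    rw [Finset.sum_range_succ, ih]
    have hat' : ∀ k : ℕ, a * q * (q * t) * q ^ k ≠ 1 := fun k h => hat (k + 1) (by rw [← h]; ring)
    have n1 := qPoch_ne_zero (base_mul_pow_ne_one hq) N
    have n2 := qPoch_ne_zero hab N
    have n3 := qPoch_ne_zero hac N
    have n4 := qPoch_ne_zero hat' N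
    have m1 : 1 - q * q ^ N ≠ 0 := fun h => base_mul_pow_ne_one hq N (by linear_combination -h)
    have m2 : 1 - a * q / b * q ^ N ≠ 0 := fun h => hab N (by linear_combination -h)
    have m3 : 1 - a * q / c * q ^ N ≠ 0 := fun h => hac N (by linear_combination -h)
    have m4 : 1 - a * q * (q * t) * q ^ N ≠ 0 := fun h => hat' N (by linear_combination -h)
    have m5 : 1 - a * q * t ≠ 0 := fun h => hat 0 (by linear_combination -h)
    have m6 : 1 - a * q * q ^ N ≠ 0 := fun h => ha (N + 1) (by rw [pow_succ']; linear_combination -h)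
    -- Splitting off the first factor of (a;q)_{N+1} cancels 1 − a; doing so for (aqt;q)_{N+1}
    -- produces the same (aq·qt;q)_N as in the series at qt.
    rw [vwpPartial, vwpPartial, vwpTerm, vwpTerm, qFalling_mul_base_succ, qFalling_succ t,
      qPoch_succ' a, qPoch_succ' (a * q * t), qPoch_succ (a * q), qPoch_succ b, qPoch_succ c,
      qPoch_succ q, qPoch_succ (a * q / b), qPoch_succ (a * q / c), qPoch_succ (a * q * (q * t)),
      show a * q * t * q = a * q * (q * t) by ring, pow_succ (a * q / (b * c)), pow_mul', pow_succ q]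
    generalize qPoch (a * q) q N = A1 at *
    generalize qPoch b q N = A2 at *
    generalize qPoch c q N = A3 at *
    generalize qPoch q q N = A4 at *
    generalize qPoch (a * q / b) q N = A5 at *
    generalize qPoch (a * q / c) q N = A6 at *
    generalize qPoch (a * q * (q * t)) q N = A7 at *
    generalize qFalling t q N = A8 at *
    generalize (a * q / (b * c)) ^ N = A9 at *
    generalize q ^ N = u at *
    have m2' : b - a * q * u ≠ 0 := by
      intro h; apply m2; field_simp; simpa using h
    have m3' : c - a * q * u ≠ 0 := by
      intro h; apply m3; field_simp; simpa using h
    rw [show 1 - a * q / b * u = (b - a * q * u) / b by field_simp,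
      show 1 - a * q / c * u = (c - a * q * u) / c by field_simp]
    generalize hW : 1 - a * q * (q * t) * u = W at *
    generalize hV : b - a * q * u = V at *
    generalize hU : c - a * q * u = U at *
    field_simp
    rw [← hW, ← hV, ← hU]
    ring

end

section

variable {a b c q t : ℂ} (hq : ‖q‖ < 1) (ha : ∀ k : ℕ, a * q ^ k ≠ 1)
  (hb : b ≠ 0) (hc : c ≠ 0) (hab : ∀ k : ℕ, a * q / b * q ^ k ≠ 1)
  (hac : ∀ k : ℕ, a * q / c * q ^ k ≠ 1) (hat : ∀ k : ℕ, a * q * t * q ^ k ≠ 1)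
  (ht : t ≠ 0) (hσ : ‖a * q / (b * c) * t‖ < 1)

include hq

theorem tendsto_inv_qPoch (ha : ∀ k : ℕ, a * q ^ k ≠ 1) :
    Tendsto (fun n => (qPoch a q n)⁻¹) atTop (𝓝 (qPochInf a q)⁻¹) :=
  (tendsto_qPoch hq a).inv₀ fun h =>
    let ⟨k, hk⟩ := (qPochInf_eq_zero_iff hq a).1 h
    ha k hk

include hab hac hat ht

/-- The constant does not depend on N: (aq·q^N t;q)_n is a quotient of two symbols (aqt;q)_m, which
are bounded above and away from zero, and ‖q^N t‖ ≤ ‖t‖ controls the falling product. -/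
theorem exists_norm_vwpTerm_le : ∃ C, 0 ≤ C ∧ ∀ N n : ℕ,
    ‖vwpTerm a b c q (q ^ N * t) n‖ ≤ C * ‖a * q / (b * c) * t‖ ^ n := by
  have hpow : Tendsto (fun n : ℕ => q ^ (2 * n)) atTop (𝓝 0) :=
    (tendsto_pow_atTop_nhds_zero_of_norm_lt_one hq).comp (tendsto_id.const_mul_atTop' two_pos)
  obtain ⟨C₁, hC₁0, hC₁⟩ := exists_norm_le_of_tendsto
    ((((((hpow.const_mul a).const_sub 1).div_const (1 - a)).mul
      (((tendsto_qPoch hq a).mul (tendsto_qPoch hq b)).mul (tendsto_qPoch hq c))).mul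
      (tendsto_inv_qPoch hq (base_mul_pow_ne_one hq))).mul
      ((tendsto_inv_qPoch hq hab).mul (tendsto_inv_qPoch hq hac)))
  obtain ⟨C₂, hC₂0, hC₂⟩ := exists_norm_qPoch_le hq (a * q * t)
  obtain ⟨C₃, hC₃0, hC₃⟩ := exists_norm_inv_qPoch_le hq hat
  obtain ⟨C₄, hC₄0, hC₄⟩ := exists_norm_qFalling_le hq (norm_pos_iff.2 ht)
  refine ⟨C₁ * (C₂ * C₃) * C₄, by positivity, fun N n => ?_⟩
  have h3 : ‖(qPoch (a * q * (q ^ N * t)) q n)⁻¹‖ ≤ C₂ * C₃ := by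
    have h := qPoch_add (a * q * t) q N n
    have hN := qPoch_ne_zero hat N
    rw [show a * q * (q ^ N * t) = a * q * t * q ^ N by ring, eq_div_of_mul_eq hN
      ((mul_comm _ _).trans h.symm), inv_div, div_eq_mul_inv, norm_mul]
    exact mul_le_mul (hC₂ N) (hC₃ _) (norm_nonneg _) hC₂0.le
  have h4 : ‖qFalling (q ^ N * t) q n‖ ≤ C₄ * ‖t‖ ^ n := by
    refine hC₄ _ ?_ n
    rw [norm_mul, norm_pow]
    exact mul_le_of_le_one_left (norm_nonneg t) (pow_le_one₀ (norm_nonneg q) hq.le)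
  have h5 : vwpTerm a b c q (q ^ N * t) n =
      (((1 - a * q ^ (2 * n)) / (1 - a) * (qPoch a q n * qPoch b q n * qPoch c q n) *
        (qPoch q q n)⁻¹ * ((qPoch (a * q / b) q n)⁻¹ * (qPoch (a * q / c) q n)⁻¹)) *
        (qPoch (a * q * (q ^ N * t)) q n)⁻¹ * qFalling (q ^ N * t) q n) * (a * q / (b * c)) ^ n := by
    simp only [vwpTerm, div_eq_mul_inv, mul_inv]
    ring
  rw [h5, norm_mul, norm_mul, norm_mul, norm_mul _ t, mul_pow, norm_pow]
  calc _ ≤ C₁ * (C₂ * C₃) * (C₄ * ‖t‖ ^ n) * ‖a * q / (b * c)‖ ^ n := by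
        gcongr
        exact hC₁ n
    _ = _ := by ring

include hσ

theorem summable_vwpTerm : Summable (vwpTerm a b c q t) := by
  obtain ⟨C, -, hC⟩ := exists_norm_vwpTerm_le hq hab hac hat ht
  refine Summable.of_norm_bounded
    ((summable_geometric_of_lt_one (norm_nonneg _) hσ).mul_left C) fun n => ?_
  simpa using hC 0 n

theorem tendsto_tsum_vwpTerm : Tendsto (fun N : ℕ => ∑' n, vwpTerm a b c q (q ^ N * t) n) atTop
    (𝓝 (∑' n, vwpTerm a b c q 0 n)) := by
  obtain ⟨C, -, hC⟩ := exists_norm_vwpTerm_le hq hab hac hat ht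
  refine tendsto_tsum_of_dominated_convergence
    ((summable_geometric_of_lt_one (norm_nonneg _) hσ).mul_left C) (fun n => ?_)
    (Eventually.of_forall fun N n => hC N n)
  have h0 : Tendsto (fun N : ℕ => q ^ N * t) atTop (𝓝 0) := by
    simpa using (tendsto_pow_atTop_nhds_zero_of_norm_lt_one hq).mul_const t
  have hc : ContinuousAt (fun t => vwpTerm a b c q t n) 0 := by
    have h1 : ContinuousAt (fun t => qFalling t q n) 0 := by unfold qFalling; fun_prop
    have h2 : ContinuousAt (fun t => qPoch (a * q * t) q n) 0 := by unfold qPoch; fun_prop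
    refine ContinuousAt.mul (ContinuousAt.div ?_ ?_ ?_) continuousAt_const
    · exact continuousAt_const.mul (continuousAt_const.mul h1)
    · exact continuousAt_const.mul h2
    · refine mul_ne_zero (mul_ne_zero (mul_ne_zero ?_ ?_) ?_) ?_
      · exact qPoch_ne_zero (base_mul_pow_ne_one hq) n
      · exact qPoch_ne_zero hab n
      · exact qPoch_ne_zero hac n
      · exact qPoch_ne_zero (fun k => by simp) n
  exact hc.tendsto.comp h0

theorem tendsto_vwpPartial : Tendsto (vwpPartial a b c q t) atTop (𝓝 0) := by
  have hat' : ∀ k : ℕ, a * q * (q * t) * q ^ k ≠ 1 := fun k h => hat (k + 1) (by rw [← h]; ring)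
  obtain ⟨C, -, hC⟩ := exists_norm_qFalling_le hq (norm_pos_iff.2 ht)
  have h1 : Tendsto (fun n => qFalling t q n * (a * q / (b * c)) ^ n) atTop (𝓝 0) := by
    have h := (tendsto_pow_atTop_nhds_zero_of_lt_one (norm_nonneg _) hσ).const_mul C
    rw [mul_zero] at h
    refine squeeze_zero_norm (fun n => ?_) h
    rw [norm_mul, norm_pow, norm_mul _ t, mul_pow]
    calc _ ≤ C * ‖t‖ ^ n * ‖a * q / (b * c)‖ ^ n := by
          gcongr
          exact hC t le_rfl n
      _ = _ := by ring
  have h2 := ((((tendsto_qPoch hq (a * q)).mul (((tendsto_qPoch hq b).comp (tendsto_add_atTop_nat 1)).mul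
    ((tendsto_qPoch hq c).comp (tendsto_add_atTop_nat 1)))).mul
    (tendsto_inv_qPoch hq (base_mul_pow_ne_one hq))).mul
    (((tendsto_inv_qPoch hq hab).mul (tendsto_inv_qPoch hq hac)).mul
    (tendsto_inv_qPoch hq hat'))).const_mul (a * q * t / (b * c))
  have h3 := h2.mul h1
  rw [mul_zero] at h3
  refine h3.congr fun n => ?_
  simp only [vwpPartial, Function.comp, qPoch_succ b, qPoch_succ c, div_eq_mul_inv, mul_inv]
  ring

include ha hb hc

theorem tsum_vwpTerm_mul_base :
    (1 - a * q * t / b) * (1 - a * q * t / c) * ∑' n, vwpTerm a b c q (q * t) n =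
      (1 - a * q * t) * (1 - a * q * t / (b * c)) * ∑' n, vwpTerm a b c q t n := by
  have hs := summable_vwpTerm hq hab hac hat ht hσ
  have hs' : Summable (vwpTerm a b c q (q * t)) := by
    obtain ⟨C, -, hC⟩ := exists_norm_vwpTerm_le hq hab hac hat ht
    refine Summable.of_norm_bounded
      ((summable_geometric_of_lt_one (norm_nonneg _) hσ).mul_left C) fun n => ?_
    simpa using hC 1 n
  have h1 := (hs'.hasSum.mul_left ((1 - a * q * t / b) * (1 - a * q * t / c))).sub
    (hs.hasSum.mul_left ((1 - a * q * t) * (1 - a * q * t / (b * c))))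
  have h2 := h1.tendsto_sum_nat.comp (tendsto_add_atTop_nat 1)
  refine sub_eq_zero.1 (tendsto_nhds_unique h2 ?_)
  refine (tendsto_vwpPartial hq hab hac hat ht hσ).congr fun n => ?_
  exact (sum_vwpTerm_sub hq ha hb hc hab hac hat n).symm

/-- Iterating the contiguous relation N times collects finite symbols on both sides; N → ∞ turns
them into infinite ones and sends q^N t to 0. For q = 0 a single application already reaches 0. -/
theorem tsum_vwpTerm_zero :
    qPochInf (a * q * t / b) q * qPochInf (a * q * t / c) q * ∑' n, vwpTerm a b c q 0 n =
      qPochInf (a * q * t) q * qPochInf (a * q * t / (b * c)) q * ∑' n, vwpTerm a b c q t n := by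
  rcases eq_or_ne q 0 with rfl | hq0
  · have h1 := tsum_vwpTerm_mul_base hq ha hb hc hab hac hat ht hσ
    simpa [qPochInf_zero_left] using h1
  have hN : ∀ N : ℕ, qPoch (a * q * t / b) q N * qPoch (a * q * t / c) q N *
      ∑' n, vwpTerm a b c q (q ^ N * t) n =
      qPoch (a * q * t) q N * qPoch (a * q * t / (b * c)) q N * ∑' n, vwpTerm a b c q t n := by
    intro N
    induction N with
    | zero => simp [qPoch_zero]
    | succ N ih =>
      have h1 := tsum_vwpTerm_mul_base (t := q ^ N * t) hq ha hb hc hab hac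
        (fun k h => hat (N + k) (by rw [← h]; ring)) (mul_ne_zero (pow_ne_zero N hq0) ht) (by
          rw [mul_left_comm, norm_mul, norm_pow]
          exact (mul_le_of_le_one_left (norm_nonneg _)
            (pow_le_one₀ (norm_nonneg q) hq.le)).trans_lt hσ)
      rw [← mul_assoc q, ← pow_succ'] at h1
      simp only [qPoch_succ]
      rw [show a * q * t / b * q ^ N = a * q * (q ^ N * t) / b by ring,
        show a * q * t / c * q ^ N = a * q * (q ^ N * t) / c by ring,
        show a * q * t * q ^ N = a * q * (q ^ N * t) by ring,
        show a * q * t / (b * c) * q ^ N = a * q * (q ^ N * t) / (b * c) by ring]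
      linear_combination (qPoch (a * q * t / b) q N * qPoch (a * q * t / c) q N) * h1 +
        (1 - a * q * (q ^ N * t)) * (1 - a * q * (q ^ N * t) / (b * c)) * ih
  have h1 := ((tendsto_qPoch hq (a * q * t / b)).mul (tendsto_qPoch hq (a * q * t / c))).mul
    (tendsto_tsum_vwpTerm hq hab hac hat ht hσ)
  refine tendsto_nhds_unique (h1.congr hN) ?_
  exact ((tendsto_qPoch hq _).mul (tendsto_qPoch hq _)).mul_const _

/-- Rogers' nonterminating very-well-poised `₆φ₅` sum, with the fourth parameter equal to `t⁻¹`. -/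
theorem tsum_vwpTerm (hbc : ‖a * q / (b * c)‖ < 1) :
    qPochInf (a * q * t) q * qPochInf (a * q * t / (b * c)) q *
        (qPochInf (a * q / b) q * qPochInf (a * q / c) q) * ∑' n, vwpTerm a b c q t n =
      qPochInf (a * q) q * qPochInf (a * q / (b * c)) q *
        (qPochInf (a * q * t / b) q * qPochInf (a * q * t / c) q) := by
  have h1a : 1 - a ≠ 0 := fun h => ha 0 (by linear_combination -h)
  have h1 := tsum_vwpTerm_zero hq ha hb hc hab hac hat ht hσ
  -- At t = 1 the convergence condition becomes `hbc`. All terms with n ≥ 1 vanish there, so the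
  -- series is 1 and fixes the value at t = 0.
  have h2 := tsum_vwpTerm_zero (t := 1) hq ha hb hc hab hac
    (fun k h => ha (k + 1) (by rw [← h]; ring)) one_ne_zero (by rwa [mul_one])
  have h3 : ∑' n, vwpTerm a b c q 1 n = 1 := by
    rw [tsum_eq_single 0 fun n hn => ?_]
    · simp [vwpTerm, qPoch_zero, qFalling, h1a]
    · obtain ⟨m, rfl⟩ := Nat.exists_eq_succ_of_ne_zero hn
      simp [vwpTerm, qFalling_one_succ]
  simp only [mul_one, h3] at h2
  linear_combination (-(qPochInf (a * q / b) q * qPochInf (a * q / c) q)) * h1 +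
    (qPochInf (a * q * t / b) q * qPochInf (a * q * t / c) q) * h2

end

/-! ### The Askey-Wilson integral: continuity and the contiguous relation -/

theorem Continuous.qPochInf_comp {Y : Type*} [TopologicalSpace Y] {f g : Y → ℂ} (hf : Continuous f)
    (hg : Continuous g) (h : ∀ y, ‖g y‖ < 1) : Continuous fun y => qPochInf (f y) (g y) :=
  continuous_iff_continuousAt.2 fun y =>
    ContinuousAt.comp (g := fun p : ℂ × ℂ => qPochInf p.1 p.2) (f := fun y => (f y, g y))
      (continuousAt_qPochInf (f y) (h y)) (hf.prodMk hg).continuousAt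

theorem continuous_circleIntegral {X : Type*} [TopologicalSpace X] {f : X → ℂ → ℂ}
    (hf : Continuous fun p : X × ℝ => f p.1 (circleMap 0 1 p.2)) :
    Continuous fun x => ∮ z in C(0, 1), f x z := by
  unfold circleIntegral
  refine intervalIntegral.continuous_parametric_intervalIntegral_of_continuous' ?_ _ _
  simp only [Function.uncurry_def, deriv_circleMap, smul_eq_mul]
  exact (((continuous_circleMap 0 1).comp continuous_snd).mul continuous_const).mul hf

/-- The Askey-Wilson integrand with its four parameters listed separately. -/
noncomputable def awIntegrand (q a b c d z : ℂ) : ℂ :=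
  z⁻¹ * ((qPochInf (z ^ 2) q * qPochInf ((z ^ 2)⁻¹) q) /
    (qPochInf (a * z) q * qPochInf (a * z⁻¹) q * (qPochInf (b * z) q * qPochInf (b * z⁻¹) q) *
      (qPochInf (c * z) q * qPochInf (c * z⁻¹) q) * (qPochInf (d * z) q * qPochInf (d * z⁻¹) q)))

/-- The unnormalised Askey-Wilson integral with its four parameters listed separately. -/
noncomputable def awIntegral (q a b c d : ℂ) : ℂ := ∮ z in C(0, 1), awIntegrand q a b c d z

theorem askeyWilsonIntegral_eq (q : ℂ) (a : Fin 4 → ℂ) :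
    askeyWilsonIntegral q a =
      (2 * (Real.pi : ℂ) * Complex.I)⁻¹ * awIntegral q (a 0) (a 1) (a 2) (a 3) := by
  simp only [askeyWilsonIntegral, awIntegral, awIntegrand, Fin.prod_univ_four]

theorem awIntegral_rotate (q a b c d : ℂ) : awIntegral q a b c d = awIntegral q b c d a := by
  unfold awIntegral
  congr 1
  ext z
  rw [awIntegrand, awIntegrand]
  congr 2
  ring

/-- Used twice: with fixed base while the parameters shrink to 0, and with fixed parameters while
the base tends to 0. -/
theorem continuous_awIntegral {X : Type*} [TopologicalSpace X] {Q A B C D : X → ℂ}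
    (hQ : Continuous Q) (hA : Continuous A) (hB : Continuous B) (hC : Continuous C)
    (hD : Continuous D) (hQ1 : ∀ x, ‖Q x‖ < 1) (hA1 : ∀ x, ‖A x‖ < 1) (hB1 : ∀ x, ‖B x‖ < 1)
    (hC1 : ∀ x, ‖C x‖ < 1) (hD1 : ∀ x, ‖D x‖ < 1) :
    Continuous fun x => awIntegral (Q x) (A x) (B x) (C x) (D x) := by
  refine continuous_circleIntegral ?_
  have hz : Continuous fun p : X × ℝ => circleMap 0 1 p.2 :=
    (continuous_circleMap 0 1).comp continuous_snd
  have hz0 : ∀ p : X × ℝ, circleMap 0 1 p.2 ≠ 0 := fun p => circleMap_ne_center one_ne_zero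
  have hz1 : ∀ p : X × ℝ, ‖circleMap 0 1 p.2‖ = 1 := fun p => by simp
  have hzi := hz.inv₀ hz0
  have hQ' : Continuous fun p : X × ℝ => Q p.1 := hQ.comp continuous_fst
  have hQ1' : ∀ p : X × ℝ, ‖Q p.1‖ < 1 := fun p => hQ1 p.1
  have hP : ∀ {F : X → ℂ}, Continuous F → Continuous fun p : X × ℝ =>
      qPochInf (F p.1 * circleMap 0 1 p.2) (Q p.1) * qPochInf (F p.1 * (circleMap 0 1 p.2)⁻¹) (Q p.1) :=
    fun hF => (Continuous.qPochInf_comp ((hF.comp continuous_fst).mul hz) hQ' hQ1').mul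
      (Continuous.qPochInf_comp ((hF.comp continuous_fst).mul hzi) hQ' hQ1')
  have hN : ∀ {F : X → ℂ}, (∀ x, ‖F x‖ < 1) → ∀ p : X × ℝ,
      qPochInf (F p.1 * circleMap 0 1 p.2) (Q p.1) *
        qPochInf (F p.1 * (circleMap 0 1 p.2)⁻¹) (Q p.1) ≠ 0 := fun hF p =>
    mul_ne_zero (qPochInf_ne_zero (hQ1 _) (by rw [norm_mul, hz1, mul_one]; exact hF _))
      (qPochInf_ne_zero (hQ1 _) (by rw [norm_mul, norm_inv, hz1, inv_one, mul_one]; exact hF _))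
  refine hzi.mul (((Continuous.qPochInf_comp (hz.pow 2) hQ' hQ1').mul
    (Continuous.qPochInf_comp ((hz.pow 2).inv₀ fun p => pow_ne_zero 2 (hz0 p)) hQ' hQ1')).div
    ((((hP hA).mul (hP hB)).mul (hP hC)).mul (hP hD)) fun p => ?_)
  exact mul_ne_zero (mul_ne_zero (mul_ne_zero (hN hA1 p) (hN hB1 p)) (hN hC1 p)) (hN hD1 p)

/-- The form dz/z is invariant under multiplication by w: the modulus of w changes the radius, and
its argument only shifts the angle, which periodicity absorbs. No regularity of f is needed. -/
theorem circleIntegral_inv_mul_mul_left (f : ℂ → ℂ) {w : ℂ} (hw : w ≠ 0) :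
    (∮ z in C(0, 1), z⁻¹ * f (w * z)) = ∮ z in C(0, ‖w‖), z⁻¹ * f z := by
  have key : ∀ R : ℝ, R ≠ 0 → ∀ g : ℂ → ℂ, (∮ z in C(0, R), z⁻¹ * g z) =
      ∫ θ in (0 : ℝ)..2 * Real.pi, Complex.I * g (circleMap 0 R θ) := by
    intro R hR g
    unfold circleIntegral
    congr 1
    ext θ
    have : circleMap 0 R θ ≠ 0 := circleMap_ne_center hR
    simp only [deriv_circleMap, smul_eq_mul]
    field_simp
  rw [key 1 one_ne_zero (fun z => f (w * z)), key _ (norm_ne_zero_iff.2 hw)]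
  have h1 : ∀ θ : ℝ, w * circleMap 0 1 θ = circleMap 0 ‖w‖ (θ + Complex.arg w) := fun θ => by
    conv_lhs => rw [← Complex.norm_mul_exp_arg_mul_I w]
    simp only [circleMap, zero_add, Complex.ofReal_one, one_mul, Complex.ofReal_add, add_mul,
      Complex.exp_add]
    ring
  simp only [h1]
  rw [intervalIntegral.integral_comp_add_right
    (fun θ => Complex.I * f (circleMap 0 ‖w‖ θ)) (Complex.arg w), zero_add, add_comm]
  have hper : Function.Periodic (fun θ => Complex.I * f (circleMap 0 ‖w‖ θ)) (2 * Real.pi) :=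
    fun θ => by simp only [periodic_circleMap 0 ‖w‖ θ]
  simpa using hper.intervalIntegral_add_eq (Complex.arg w) 0

/-- Cauchy's theorem on the annulus moves the contour from radius 1 to ‖q‖; rescaling by q brings it
back to the unit circle. -/
theorem circleIntegral_inv_mul_eq_mul_base {q : ℂ} (hq : ‖q‖ < 1) (hq0 : q ≠ 0) {F : ℂ → ℂ}
    (hF : ∀ z, ‖q‖ ≤ ‖z‖ → ‖z‖ ≤ 1 → DifferentiableAt ℂ F z) :
    (∮ z in C(0, 1), z⁻¹ * F z) = ∮ z in C(0, 1), z⁻¹ * F (q * z) := by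
  have h := Complex.circleIntegral_sub_center_inv_smul_eq_of_differentiable_on_annulus_off_countable
    (c := 0) (f := F) (s := ∅) (norm_pos_iff.2 hq0) hq.le Set.countable_empty
    (fun z hz => (hF z (by simpa using hz.2) (by simpa using hz.1)).continuousAt.continuousWithinAt)
    (fun z hz => hF z (by simpa using (not_le.1 fun h => hz.1.2 (by simpa using h)).le)
      (by simpa using (Metric.mem_ball.1 hz.1.1).le))
  simp only [sub_zero, smul_eq_mul] at h
  rw [h, circleIntegral_inv_mul_mul_left F hq0]

/-- The function whose `q`-difference gives the contiguous relation of the Askey-Wilson integral. -/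
noncomputable def awPotential (q a b c d z : ℂ) : ℂ :=
  z ^ 3 * ((qPochInf (q * z ^ 2) q * qPochInf ((z ^ 2)⁻¹) q) /
    (qPochInf (a * z) q * qPochInf (q * (a * z⁻¹)) q *
      (qPochInf (b * z) q * qPochInf (q * (b * z⁻¹)) q) *
      (qPochInf (c * z) q * qPochInf (q * (c * z⁻¹)) q) *
      (qPochInf (d * z) q * qPochInf (q * (d * z⁻¹)) q)))

section

variable {q a b c d : ℂ} (hq : ‖q‖ < 1) (ha : ‖a‖ < 1) (hb : ‖b‖ < 1) (hc : ‖c‖ < 1) (hd : ‖d‖ < 1)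

include hq ha hb hc hd

/-- The shift by q in the factors with z⁻¹ is what keeps the denominator nonzero: ‖q·u·z⁻¹‖ < 1 down
to the inner radius ‖z‖ = ‖q‖. -/
theorem differentiableAt_awPotential (hq0 : q ≠ 0) {z : ℂ} (h1 : ‖q‖ ≤ ‖z‖) (h2 : ‖z‖ ≤ 1) :
    DifferentiableAt ℂ (awPotential q a b c d) z := by
  have hq' : 0 < ‖q‖ := norm_pos_iff.2 hq0
  have hz' : 0 < ‖z‖ := hq'.trans_le h1
  have hz : z ≠ 0 := norm_pos_iff.1 hz'
  have hne : ∀ u : ℂ, ‖u‖ < 1 → qPochInf (u * z) q * qPochInf (q * (u * z⁻¹)) q ≠ 0 := by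
    intro u hu
    refine mul_ne_zero (qPochInf_ne_zero hq ?_) (qPochInf_ne_zero hq ?_)
    · rw [norm_mul]
      exact (mul_le_of_le_one_right (norm_nonneg u) h2).trans_lt hu
    · rw [norm_mul, norm_mul, norm_inv, mul_left_comm]
      exact (mul_le_of_le_one_right (norm_nonneg u) (by rwa [← div_eq_mul_inv, div_le_one hz'])).trans_lt hu
  have hcomp : ∀ g : ℂ → ℂ, DifferentiableAt ℂ g z → DifferentiableAt ℂ (fun z => qPochInf (g z) q) z :=
    fun g hg => DifferentiableAt.comp (g := fun a => qPochInf a q) z (differentiable_qPochInf hq _) hg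
  have hd : ∀ u : ℂ, DifferentiableAt ℂ
      (fun z => qPochInf (u * z) q * qPochInf (q * (u * z⁻¹)) q) z := fun u =>
    (hcomp _ (by fun_prop)).fun_mul (hcomp _ (((differentiableAt_inv hz).const_mul u).const_mul q))
  have hnum : DifferentiableAt ℂ (fun z => qPochInf (q * z ^ 2) q * qPochInf ((z ^ 2)⁻¹) q) z :=
    (hcomp _ (by fun_prop)).fun_mul
      (hcomp _ ((differentiableAt_pow 2).fun_inv (pow_ne_zero 2 hz)))
  refine (differentiableAt_pow 3).fun_mul (hnum.fun_div
    ((((hd a).fun_mul (hd b)).fun_mul (hd c)).fun_mul (hd d)) ?_)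
  exact mul_ne_zero (mul_ne_zero (mul_ne_zero (hne a ha) (hne b hb)) (hne c hc)) (hne d ‹_›)

theorem awIntegrand_contiguous (hq0 : q ≠ 0) {z : ℂ} (hz : ‖z‖ = 1) :
    (1 - a * b * c * d) * awIntegrand q (q * a) b c d z -
        (1 - a * b) * (1 - a * c) * (1 - a * d) * awIntegrand q a b c d z =
      a * (z⁻¹ * awPotential q a b c d z - z⁻¹ * awPotential q a b c d (q * z)) := by
  have hz0 : z ≠ 0 := norm_pos_iff.1 (hz ▸ one_pos)
  have hne : ∀ u : ℂ, ‖u‖ < 1 → qPochInf (q * (u * z)) q ≠ 0 ∧ qPochInf (q * (u * z⁻¹)) q ≠ 0 ∧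
      1 - u * z ≠ 0 ∧ 1 - u * z⁻¹ ≠ 0 := by
    intro u hu
    have e1 : ‖u * z‖ < 1 := by rwa [norm_mul, hz, mul_one]
    have e2 : ‖u * z⁻¹‖ < 1 := by rwa [norm_mul, norm_inv, hz, inv_one, mul_one]
    have e3 : ∀ v : ℂ, ‖v‖ < 1 → ‖q * v‖ < 1 := fun v hv => by
      rw [norm_mul]
      exact (mul_le_of_le_one_left (norm_nonneg v) hq.le).trans_lt hv
    refine ⟨qPochInf_ne_zero hq (e3 _ e1), qPochInf_ne_zero hq (e3 _ e2), fun h => ?_, fun h => ?_⟩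
    · rw [← sub_eq_zero.1 h, norm_one] at e1
      exact e1.false
    · rw [← sub_eq_zero.1 h, norm_one] at e2
      exact e2.false
  have hs : ∀ u : ℂ, qPochInf (u * z) q = (1 - u * z) * qPochInf (q * (u * z)) q := fun u => by
    rw [qPochInf_eq_one_sub_mul hq, mul_comm _ q]
  have hi : ∀ u : ℂ, qPochInf (u * z⁻¹) q = (1 - u * z⁻¹) * qPochInf (q * (u * z⁻¹)) q := fun u => by
    rw [qPochInf_eq_one_sub_mul hq, mul_comm _ q]
  have h2 : qPochInf (z ^ 2) q = (1 - z ^ 2) * ((1 - q * z ^ 2) * ((1 - q ^ 2 * z ^ 2) *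
      qPochInf (q * (q * z) ^ 2) q)) := by
    rw [qPochInf_eq_one_sub_mul hq (z ^ 2), qPochInf_eq_one_sub_mul hq (z ^ 2 * q),
      qPochInf_eq_one_sub_mul hq (z ^ 2 * q * q)]
    ring_nf
  have h2' : qPochInf (q * z ^ 2) q = (1 - q * z ^ 2) * ((1 - q ^ 2 * z ^ 2) *
      qPochInf (q * (q * z) ^ 2) q) := by
    rw [qPochInf_eq_one_sub_mul hq (q * z ^ 2), qPochInf_eq_one_sub_mul hq (q * z ^ 2 * q)]
    ring_nf
  have h3 : qPochInf (((q * z) ^ 2)⁻¹) q = (1 - ((q * z) ^ 2)⁻¹) * ((1 - (q * z ^ 2)⁻¹) *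
      qPochInf ((z ^ 2)⁻¹) q) := by
    rw [qPochInf_eq_one_sub_mul hq (((q * z) ^ 2)⁻¹),
      show ((q * z) ^ 2)⁻¹ * q = (q * z ^ 2)⁻¹ by field_simp, qPochInf_eq_one_sub_mul hq ((q * z ^ 2)⁻¹),
      show (q * z ^ 2)⁻¹ * q = (z ^ 2)⁻¹ by field_simp]
  have hj : ∀ u : ℂ, q * (u * (q * z)⁻¹) = u * z⁻¹ := fun u => by field_simp
  have hk : ∀ u : ℂ, u * (q * z) = q * (u * z) := fun u => by ring
  obtain ⟨a1, a2, a3, a4⟩ := hne a ha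
  obtain ⟨b1, b2, b3, b4⟩ := hne b hb
  obtain ⟨c1, c2, c3, c4⟩ := hne c hc
  obtain ⟨d1, d2, d3, d4⟩ := hne d hd
  -- Every infinite product is now a rational multiple of one of ten common ones, so after
  -- cancellation a rational identity in z, q and the parameters remains.
  simp only [awIntegrand, awPotential, h2, h2', h3, hj, hk, hs, hi, mul_assoc q a]
  generalize qPochInf (q * (a * z)) q = A1 at *
  generalize qPochInf (q * (b * z)) q = B1 at *
  generalize qPochInf (q * (c * z)) q = C1 at *
  generalize qPochInf (q * (d * z)) q = D1 at *
  generalize qPochInf (q * (a * z⁻¹)) q = A2 at *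
  generalize qPochInf (q * (b * z⁻¹)) q = B2 at *
  generalize qPochInf (q * (c * z⁻¹)) q = C2 at *
  generalize qPochInf (q * (d * z⁻¹)) q = D2 at *
  generalize qPochInf (q * (q * z) ^ 2) q = X
  generalize qPochInf ((z ^ 2)⁻¹) q = Y
  have hm : ∀ u : ℂ, 1 - u * z⁻¹ = (z - u) / z := fun u => by field_simp
  simp only [hm] at a4 b4 c4 d4 ⊢
  have a5 : z - a ≠ 0 := (div_ne_zero_iff.1 a4).1
  have b5 : z - b ≠ 0 := (div_ne_zero_iff.1 b4).1
  have c5 : z - c ≠ 0 := (div_ne_zero_iff.1 c4).1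
  have d5 : z - d ≠ 0 := (div_ne_zero_iff.1 d4).1
  field_simp
  ring

theorem circleIntegrable_awIntegrand : CircleIntegrable (awIntegrand q a b c d) 0 1 := by
  refine ContinuousOn.circleIntegrable zero_le_one fun z hz => ?_
  have hz : ‖z‖ = 1 := by simpa using hz
  have hz0 : z ≠ 0 := norm_pos_iff.1 (hz ▸ one_pos)
  have hcomp : ∀ g : ℂ → ℂ, ContinuousAt g z → ContinuousAt (fun z => qPochInf (g z) q) z :=
    fun g hg => ContinuousAt.comp (g := fun a => qPochInf a q) (continuous_qPochInf hq).continuousAt hg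
  have hi : ContinuousAt (fun z : ℂ => z⁻¹) z := continuousAt_inv₀ hz0
  have hp : ∀ u : ℂ, ContinuousAt (fun z => qPochInf (u * z) q * qPochInf (u * z⁻¹) q) z := fun u =>
    (hcomp _ (by fun_prop)).mul (hcomp _ (continuousAt_const.mul hi))
  have hne : ∀ u : ℂ, ‖u‖ < 1 → qPochInf (u * z) q * qPochInf (u * z⁻¹) q ≠ 0 := fun u hu =>
    mul_ne_zero (qPochInf_ne_zero hq (by rwa [norm_mul, hz, mul_one]))
      (qPochInf_ne_zero hq (by rwa [norm_mul, norm_inv, hz, inv_one, mul_one]))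
  refine (hi.mul (((hcomp _ (by fun_prop)).mul (hcomp _
    ((continuousAt_id.pow 2).inv₀ (pow_ne_zero 2 hz0)))).div
    ((((hp a).mul (hp b)).mul (hp c)).mul (hp d)) ?_)).continuousWithinAt
  exact mul_ne_zero (mul_ne_zero (mul_ne_zero (hne a ha) (hne b hb)) (hne c hc)) (hne d hd)

theorem awIntegral_mul_base (hq0 : q ≠ 0) :
    (1 - a * b * c * d) * awIntegral q (q * a) b c d =
      (1 - a * b) * (1 - a * c) * (1 - a * d) * awIntegral q a b c d := by
  have hqa : ‖q * a‖ < 1 := by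
    rw [norm_mul]
    exact (mul_le_of_le_one_left (norm_nonneg a) hq.le).trans_lt ha
  have hd1 := fun z => differentiableAt_awPotential hq ha hb hc hd hq0 (z := z)
  have hq' : 0 < ‖q‖ := norm_pos_iff.2 hq0
  have hi : ContinuousOn (fun z : ℂ => z⁻¹) (Metric.sphere 0 1) := fun z hz =>
    (continuousAt_inv₀ (by rintro rfl; simp at hz)).continuousWithinAt
  have c1 : CircleIntegrable (fun z => z⁻¹ * awPotential q a b c d z) 0 1 := by
    refine ContinuousOn.circleIntegrable zero_le_one (hi.mul fun z hz => ?_)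
    have hz : ‖z‖ = 1 := by simpa using hz
    exact (hd1 z (by rw [hz]; exact hq.le) hz.le).continuousAt.continuousWithinAt
  have c2 : CircleIntegrable (fun z => z⁻¹ * awPotential q a b c d (q * z)) 0 1 := by
    refine ContinuousOn.circleIntegrable zero_le_one (hi.mul fun z hz => ?_)
    have hz : ‖z‖ = 1 := by simpa using hz
    refine (ContinuousAt.comp (g := awPotential q a b c d) (f := fun z => q * z)
      (hd1 (q * z) ?_ ?_).continuousAt (by fun_prop)).continuousWithinAt
    · rw [norm_mul, hz, mul_one]
    · rw [norm_mul, hz, mul_one]; exact hq.le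
  have hshift := circleIntegral_inv_mul_eq_mul_base hq hq0 (F := awPotential q a b c d) hd1
  have i1 := circleIntegrable_awIntegrand hq hqa hb hc hd
  have i2 := circleIntegrable_awIntegrand hq ha hb hc hd
  have i1' : CircleIntegrable (fun z => (1 - a * b * c * d) * awIntegrand q (q * a) b c d z) 0 1 :=
    i1.const_smul
  have i2' : CircleIntegrable
      (fun z => (1 - a * b) * (1 - a * c) * (1 - a * d) * awIntegrand q a b c d z) 0 1 :=
    i2.const_smul
  refine sub_eq_zero.1 ?_
  rw [awIntegral, awIntegral, ← circleIntegral.integral_const_mul, ← circleIntegral.integral_const_mul,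
    ← circleIntegral.integral_sub i1' i2',
    circleIntegral.integral_congr zero_le_one fun z hz =>
      awIntegrand_contiguous hq ha hb hc hd hq0 (by simpa using hz),
    circleIntegral.integral_const_mul, circleIntegral.integral_sub c1 c2, hshift, sub_self, mul_zero]

end

/-! ### Evaluation of the Askey-Wilson integral -/

/-- The Askey-Wilson integral divided by its dependence on the parameters. -/
noncomputable def awRatio (q a b c d : ℂ) : ℂ :=
  awIntegral q a b c d *
    (qPochInf (a * b) q * qPochInf (a * c) q * qPochInf (a * d) q *
      (qPochInf (b * c) q * qPochInf (b * d) q) * qPochInf (c * d) q) / qPochInf (a * b * c * d) q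

theorem norm_mul_lt_one {u v : ℂ} (hu : ‖u‖ < 1) (hv : ‖v‖ < 1) : ‖u * v‖ < 1 := by
  rw [norm_mul]
  exact (mul_le_of_le_one_left (norm_nonneg v) hu.le).trans_lt hv

theorem one_sub_ne_zero_of_norm {u : ℂ} (hu : ‖u‖ < 1) : 1 - u ≠ 0 := by
  intro h
  rw [← sub_eq_zero.1 h, norm_one] at hu
  exact hu.false

section

variable {q a b c d : ℂ} (hq : ‖q‖ < 1) (ha : ‖a‖ < 1) (hb : ‖b‖ < 1) (hc : ‖c‖ < 1) (hd : ‖d‖ < 1)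

include hq ha hb hc hd

/-- The contiguous relation is applied to a, b, c, d in turn, rotating the next parameter to the
front. Each pair uv thereby contributes (1 − uv)(1 − quv), and abcd contributes four consecutive
factors, exactly what the symbols in the ratio lose. -/
theorem awRatio_mul_base (hq0 : q ≠ 0) :
    awRatio q (q * a) (q * b) (q * c) (q * d) = awRatio q a b c d := by
  have hqa := norm_mul_lt_one hq ha
  have hqb := norm_mul_lt_one hq hb
  have hqc := norm_mul_lt_one hq hc
  have s1 := awIntegral_mul_base hq ha hb hc hd hq0
  have s2 := awIntegral_mul_base hq hb hc hd hqa hq0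
  have s3 := awIntegral_mul_base hq hc hd hqa hqb hq0
  have s4 := awIntegral_mul_base hq hd hqa hqb hqc hq0
  rw [awIntegral_rotate q (q * a)] at s1
  rw [awIntegral_rotate q (q * b)] at s2
  rw [awIntegral_rotate q (q * c)] at s3
  rw [awIntegral_rotate q (q * d)] at s4
  have habcd := norm_mul_lt_one (norm_mul_lt_one (norm_mul_lt_one ha hb) hc) hd
  have h4 := norm_mul_lt_one hq (norm_mul_lt_one hq (norm_mul_lt_one hq (norm_mul_lt_one hq habcd)))
  have n0 := one_sub_ne_zero_of_norm habcd
  have n1 := one_sub_ne_zero_of_norm (norm_mul_lt_one hq habcd)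
  have n2 := one_sub_ne_zero_of_norm (norm_mul_lt_one hq (norm_mul_lt_one hq habcd))
  have n3 := one_sub_ne_zero_of_norm
    (norm_mul_lt_one hq (norm_mul_lt_one hq (norm_mul_lt_one hq habcd)))
  have n4 := qPochInf_ne_zero hq h4
  have hs : ∀ u, qPochInf u q = (1 - u) * qPochInf (q * u) q := fun u => by
    rw [qPochInf_eq_one_sub_mul hq, mul_comm u q]
  have hp : ∀ u v, qPochInf (u * v) q =
      (1 - u * v) * ((1 - q * (u * v)) * qPochInf (q * u * (q * v)) q) := fun u v => by
    rw [hs (u * v), hs (q * (u * v)), show q * (q * (u * v)) = q * u * (q * v) by ring]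
  have hA : qPochInf (a * b * c * d) q = (1 - a * b * c * d) * ((1 - q * (a * b * c * d)) *
      ((1 - q * (q * (a * b * c * d))) * ((1 - q * (q * (q * (a * b * c * d)))) *
      qPochInf (q * (q * (q * (q * (a * b * c * d))))) q))) := by
    rw [hs (a * b * c * d), hs (q * (a * b * c * d)), hs (q * (q * (a * b * c * d))),
      hs (q * (q * (q * (a * b * c * d))))]
  rw [awRatio, awRatio, hA, hp a b, hp a c, hp a d, hp b c, hp b d, hp c d,
    show q * a * (q * b) * (q * c) * (q * d) = q * (q * (q * (q * (a * b * c * d)))) by ring,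
    div_eq_div_iff n4 (mul_ne_zero n0 (mul_ne_zero n1 (mul_ne_zero n2 (mul_ne_zero n3 n4))))]
  have key : (1 - a * b * c * d) * ((1 - q * (a * b * c * d)) *
      ((1 - q * (q * (a * b * c * d))) * (1 - q * (q * (q * (a * b * c * d)))))) *
      awIntegral q (q * a) (q * b) (q * c) (q * d) =
      (1 - a * b) * (1 - a * c) * (1 - a * d) * ((1 - b * c) * (1 - b * d) * (1 - q * (a * b))) *
      ((1 - c * d) * (1 - q * (a * c)) * (1 - q * (b * c))) *
      ((1 - q * (a * d)) * (1 - q * (b * d)) * (1 - q * (c * d))) * awIntegral q a b c d := by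
    generalize awIntegral q (q * a) (q * b) (q * c) (q * d) = J4 at *
    generalize awIntegral q d (q * a) (q * b) (q * c) = J3 at *
    generalize awIntegral q c d (q * a) (q * b) = J2 at *
    generalize awIntegral q b c d (q * a) = J1 at *
    have t4 : (1 - q * (q * (q * (a * b * c * d)))) * J4 =
      (1 - q * (a * d)) * (1 - q * (b * d)) * (1 - q * (c * d)) * J3 := by linear_combination s4
    have t3 : (1 - q * (q * (a * b * c * d))) * J3 =
      (1 - c * d) * (1 - q * (a * c)) * (1 - q * (b * c)) * J2 := by linear_combination s3
    have t2 : (1 - q * (a * b * c * d)) * J2 =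
      (1 - b * c) * (1 - b * d) * (1 - q * (a * b)) * J1 := by linear_combination s2
    generalize 1 - q * (q * (q * (a * b * c * d))) = e3 at *
    generalize 1 - q * (q * (a * b * c * d)) = e2 at *
    generalize 1 - q * (a * b * c * d) = e1 at *
    generalize 1 - a * b * c * d = e0 at *
    generalize (1 - q * (a * d)) * (1 - q * (b * d)) * (1 - q * (c * d)) = f3 at *
    generalize (1 - c * d) * (1 - q * (a * c)) * (1 - q * (b * c)) = f2 at *
    generalize (1 - b * c) * (1 - b * d) * (1 - q * (a * b)) = f1 at *
    linear_combination e0 * e1 * e2 * t4 + e0 * e1 * f3 * t3 + e0 * f3 * f2 * t2 +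
      f1 * f2 * f3 * s1
  generalize 1 - q * (a * b) = ab1 at *
  generalize 1 - a * b = ab0 at *
  generalize qPochInf (q * a * (q * b)) q = ab2
  generalize 1 - q * (a * c) = ac1 at *
  generalize 1 - a * c = ac0 at *
  generalize qPochInf (q * a * (q * c)) q = ac2
  generalize 1 - q * (a * d) = ad1 at *
  generalize 1 - a * d = ad0 at *
  generalize qPochInf (q * a * (q * d)) q = ad2
  generalize 1 - q * (b * c) = bc1 at *
  generalize 1 - b * c = bc0 at *
  generalize qPochInf (q * b * (q * c)) q = bc2
  generalize 1 - q * (b * d) = bd1 at *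
  generalize 1 - b * d = bd0 at *
  generalize qPochInf (q * b * (q * d)) q = bd2
  generalize 1 - q * (c * d) = cd1 at *
  generalize 1 - c * d = cd0 at *
  generalize qPochInf (q * c * (q * d)) q = cd2
  generalize 1 - q * (q * (q * (a * b * c * d))) = e3 at *
  generalize 1 - q * (q * (a * b * c * d)) = e2 at *
  generalize 1 - q * (a * b * c * d) = e1 at *
  generalize 1 - a * b * c * d = e0 at *
  generalize qPochInf (q * (q * (q * (q * (a * b * c * d))))) q = e4
  linear_combination (ab2 * ac2 * ad2 * (bc2 * bd2) * cd2 * e4) * key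

/-- The ratio at (sa, sb, sc, sd) is continuous for ‖s‖ ≤ 1 and takes the same value at every s =
qⁿ, hence at s = 0. -/
theorem awRatio_eq_zero_parameters (hq0 : q ≠ 0) :
    awRatio q a b c d = awIntegral q 0 0 0 0 := by
  have hqn : ∀ n : ℕ, ∀ u : ℂ, ‖u‖ < 1 → ‖q ^ n * u‖ < 1 := fun n u hu => by
    rw [norm_mul, norm_pow]
    exact (mul_le_of_le_one_left (norm_nonneg u) (pow_le_one₀ (norm_nonneg q) hq.le)).trans_lt hu
  have hN : ∀ n : ℕ, awRatio q (q ^ n * a) (q ^ n * b) (q ^ n * c) (q ^ n * d) =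
      awRatio q a b c d := by
    intro n
    induction n with
    | zero => simp
    | succ n ih =>
      rw [← ih, ← awRatio_mul_base hq (hqn n a ha) (hqn n b hb) (hqn n c hc) (hqn n d hd) hq0]
      simp only [pow_succ', mul_assoc]
  have hcont : Continuous fun s : Metric.closedBall (0 : ℂ) 1 =>
      awRatio q (s * a) (s * b) (s * c) (s * d) := by
    have h1 : ∀ u : ℂ, ‖u‖ < 1 → ∀ s : Metric.closedBall (0 : ℂ) 1, ‖(s : ℂ) * u‖ < 1 := by
      intro u hu s
      rw [norm_mul]
      exact (mul_le_of_le_one_left (norm_nonneg u) (mem_closedBall_zero_iff.1 s.2)).trans_lt hu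
    have h2 : ∀ u : ℂ, Continuous fun s : Metric.closedBall (0 : ℂ) 1 => (s : ℂ) * u :=
      fun u => continuous_subtype_val.mul continuous_const
    have h3 : ∀ u v : ℂ, Continuous fun s : Metric.closedBall (0 : ℂ) 1 =>
        qPochInf ((s : ℂ) * u * (s * v)) q :=
      fun u v => (continuous_qPochInf hq).comp ((h2 u).mul (h2 v))
    refine ((continuous_awIntegral continuous_const (h2 a) (h2 b) (h2 c) (h2 d) (fun _ => hq)
      (h1 a ha) (h1 b hb) (h1 c hc) (h1 d hd)).mul
      (((((h3 a b).mul (h3 a c)).mul (h3 a d)).mul ((h3 b c).mul (h3 b d))).mul (h3 c d))).div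
      ((continuous_qPochInf hq).comp ((((h2 a).mul (h2 b)).mul (h2 c)).mul (h2 d))) fun s => ?_
    exact qPochInf_ne_zero hq (norm_mul_lt_one (norm_mul_lt_one (norm_mul_lt_one (h1 a ha s)
      (h1 b hb s)) (h1 c hc s)) (h1 d hd s))
  have hlim : Tendsto (fun n : ℕ => (⟨q ^ n, by
      simpa using pow_le_one₀ (norm_nonneg q) hq.le⟩ : Metric.closedBall (0 : ℂ) 1)) atTop
      (𝓝 ⟨0, by simp⟩) :=
    tendsto_subtype_rng.2 (tendsto_pow_atTop_nhds_zero_of_norm_lt_one hq)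
  have h := (hcont.tendsto _).comp hlim
  have h0 : awRatio q (0 * a) (0 * b) (0 * c) (0 * d) = awIntegral q 0 0 0 0 := by
    simp [awRatio, qPochInf_zero_left]
  rw [← h0]
  exact tendsto_nhds_unique (tendsto_const_nhds.congr fun n => (hN n).symm) h

end

/-- By the splitting of (z²;q)_∞ over ±z and ±rz, the denominator cancels all but (1 − z²)(1 −
z⁻²)/z = 2/z − z − z⁻³, whose residue at 0 is 2. -/
theorem awIntegral_special {q r : ℂ} (hq : ‖q‖ < 1) (hr : r ^ 2 = q) :
    awIntegral q q (-q) r (-r) = 2 * (2 * Real.pi * Complex.I) := by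
  have hr1 : ‖r‖ < 1 := by
    have : ‖r‖ ^ 2 < 1 := by rw [← norm_pow, hr]; exact hq
    nlinarith [norm_nonneg r]
  have hz : ∀ z ∈ Metric.sphere (0 : ℂ) 1,
      awIntegrand q q (-q) r (-r) z = 2 * (z - 0)⁻¹ - ((z - 0) ^ (1 : ℤ) + (z - 0) ^ (-3 : ℤ)) := by
    intro z hz
    have hz : ‖z‖ = 1 := by simpa using hz
    have hz0 : z ≠ 0 := norm_pos_iff.1 (hz ▸ one_pos)
    have hs : ∀ w : ℂ, qPochInf (w ^ 2) q = (1 - w ^ 2) * (qPochInf (q * w) q * qPochInf (-q * w) q *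
        (qPochInf (r * w) q * qPochInf (-r * w) q)) := fun w => by
      rw [qPochInf_sq hq hr w, qPochInf_eq_one_sub_mul hq w, qPochInf_eq_one_sub_mul hq (-w),
        mul_comm w q, show -w * q = -q * w by ring, show -(r * w) = -r * w by ring]
      ring
    have hne : ∀ u : ℂ, ‖u‖ < 1 → qPochInf (u * z) q ≠ 0 ∧ qPochInf (u * z⁻¹) q ≠ 0 := fun u hu =>
      ⟨qPochInf_ne_zero hq (by rwa [norm_mul, hz, mul_one]),
        qPochInf_ne_zero hq (by rwa [norm_mul, norm_inv, hz, inv_one, mul_one])⟩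
    obtain ⟨n1, n2⟩ := hne q hq
    obtain ⟨n3, n4⟩ := hne (-q) (by rwa [norm_neg])
    obtain ⟨n5, n6⟩ := hne r hr1
    obtain ⟨n7, n8⟩ := hne (-r) (by rwa [norm_neg])
    rw [awIntegrand, ← inv_pow, hs z, hs z⁻¹, sub_zero, zpow_one,
      show z ^ (-3 : ℤ) = (z ^ 3)⁻¹ by rw [zpow_neg]; norm_cast]
    generalize qPochInf (q * z) q = A1 at *
    generalize qPochInf (-q * z) q = B1 at *
    generalize qPochInf (r * z) q = C1 at *
    generalize qPochInf (-r * z) q = D1 at *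
    generalize qPochInf (q * z⁻¹) q = A2 at *
    generalize qPochInf (-q * z⁻¹) q = B2 at *
    generalize qPochInf (r * z⁻¹) q = C2 at *
    generalize qPochInf (-r * z⁻¹) q = D2 at *
    field_simp
    ring
  have hmem : (0 : ℂ) ∉ Metric.sphere (0 : ℂ) |1| := by simp
  have i1 : CircleIntegrable (fun z : ℂ => 2 * (z - 0)⁻¹) 0 1 :=
    (circleIntegrable_sub_inv_iff.2 (Or.inr hmem)).const_smul
  have i2 : CircleIntegrable (fun z : ℂ => (z - 0) ^ (1 : ℤ)) 0 1 :=
    circleIntegrable_sub_zpow_iff.2 (Or.inr (Or.inr hmem))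
  have i3 : CircleIntegrable (fun z : ℂ => (z - 0) ^ (-3 : ℤ)) 0 1 :=
    circleIntegrable_sub_zpow_iff.2 (Or.inr (Or.inr hmem))
  have i4 : CircleIntegrable (fun z : ℂ => (z - 0) ^ (1 : ℤ) + (z - 0) ^ (-3 : ℤ)) 0 1 := i2.add i3
  rw [awIntegral, circleIntegral.integral_congr zero_le_one hz,
    circleIntegral.integral_sub i1 i4, circleIntegral.integral_add i2 i3,
    circleIntegral.integral_const_mul, circleIntegral.integral_sub_zpow_of_ne (by decide),
    circleIntegral.integral_sub_zpow_of_ne (by decide), circleIntegral.integral_sub_center_inv 0 one_ne_zero]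
  ring

theorem awIntegral_zero_parameters {q : ℂ} (hq : ‖q‖ < 1) (hq0 : q ≠ 0) :
    awIntegral q 0 0 0 0 * qPochInf q q = 2 * (2 * Real.pi * Complex.I) := by
  obtain ⟨r, hr⟩ : ∃ r : ℂ, r ^ 2 = q := IsAlgClosed.exists_pow_nat_eq q two_pos
  have hr1 : ‖r‖ < 1 := by
    have : ‖r‖ ^ 2 < 1 := by rw [← norm_pow, hr]; exact hq
    nlinarith [norm_nonneg r]
  have hqn : ‖-q‖ < 1 := by rwa [norm_neg]
  have hrn : ‖-r‖ < 1 := by rwa [norm_neg]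
  rw [← awRatio_eq_zero_parameters hq hq hqn hr1 hrn hq0, awRatio, awIntegral_special hq hr]
  have hs : ∀ u, qPochInf u q = (1 - u) * qPochInf (q * u) q := fun u => by
    rw [qPochInf_eq_one_sub_mul hq, mul_comm u q]
  have e1 : qPochInf q q = qPochInf r q * qPochInf (-r) q * (qPochInf q q * qPochInf (-q) q) := by
    have := qPochInf_sq hq hr r
    rwa [← pow_two r, hr] at this
  have nq := qPochInf_self_ne_zero hq
  -- Euler's identity (√q;q)_∞(−√q;q)_∞(−q;q)_∞ = 1, from splitting (r²;q)_∞ at x = r and cancelling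
  -- (q;q)_∞.
  have e2 : qPochInf r q * qPochInf (-r) q * qPochInf (-q) q = 1 :=
    mul_right_cancel₀ nq (by linear_combination -e1)
  rw [hs r, hs (-r)] at e2
  have e3 : qPochInf q q = (1 - q) * ((1 - q ^ 2) * qPochInf (q * -q * r * -r) q) := by
    rw [hs q, hs (q * q), show q * -q * r * -r = q * (q * q) by rw [← hr]; ring]
    ring
  have e4 : qPochInf (-q) q = (1 + q) * qPochInf (q * -q) q := by
    rw [hs (-q)]; ring
  have n3 : qPochInf (q * -q * r * -r) q ≠ 0 := fun h => nq (by rw [e3, h]; ring)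
  rw [div_mul_eq_mul_div, div_eq_iff n3, e3, show r * -r = -q by rw [← hr]; ring,
    show -q * -r = q * r by ring, show -q * r = q * -r by ring]
  rw [e4] at e2 ⊢
  have e5 : ((1 - q) * ((1 + q) * (qPochInf (q * r) q * qPochInf (q * -r) q * qPochInf (q * -q) q))) = 1 := by
    linear_combination e2 + ((1 + q) * (qPochInf (q * r) q * qPochInf (q * -r) q * qPochInf (q * -q) q)) * hr
  generalize qPochInf (q * r) q = A at *
  generalize qPochInf (q * -r) q = B at *
  generalize qPochInf (q * -q) q = C at *
  generalize qPochInf (q * -q * r * -r) q = D at *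
  -- With E the left side of `e5`, the claim reduces to E² = 1, that is (E + 1)(E − 1) = 0.
  linear_combination 2 * (2 * Real.pi * Complex.I) * D *
    (((1 - q) * ((1 + q) * (A * B * C))) + 1) * e5

theorem awIntegral_eval_of_ne_zero {q a b c d : ℂ} (hq : ‖q‖ < 1) (ha : ‖a‖ < 1) (hb : ‖b‖ < 1)
    (hc : ‖c‖ < 1) (hd : ‖d‖ < 1) (hq0 : q ≠ 0) :
    awIntegral q a b c d * (qPochInf q q * (qPochInf (a * b) q * qPochInf (a * c) q *
      qPochInf (a * d) q * (qPochInf (b * c) q * qPochInf (b * d) q) * qPochInf (c * d) q)) =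
      2 * (2 * Real.pi * Complex.I) * qPochInf (a * b * c * d) q := by
  have h1 := awRatio_eq_zero_parameters hq ha hb hc hd hq0
  have h2 := awIntegral_zero_parameters hq hq0
  have h3 : qPochInf (a * b * c * d) q ≠ 0 :=
    qPochInf_ne_zero hq (norm_mul_lt_one (norm_mul_lt_one (norm_mul_lt_one ha hb) hc) hd)
  rw [awRatio, div_eq_iff h3] at h1
  linear_combination qPochInf q q * h1 + qPochInf (a * b * c * d) q * h2

theorem awIntegral_eval {q a b c d : ℂ} (hq : ‖q‖ < 1) (ha : ‖a‖ < 1) (hb : ‖b‖ < 1)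
    (hc : ‖c‖ < 1) (hd : ‖d‖ < 1) :
    awIntegral q a b c d * (qPochInf q q * (qPochInf (a * b) q * qPochInf (a * c) q *
      qPochInf (a * d) q * (qPochInf (b * c) q * qPochInf (b * d) q) * qPochInf (c * d) q)) =
      2 * (2 * Real.pi * Complex.I) * qPochInf (a * b * c * d) q := by
  have hq1 : ∀ p : Metric.ball (0 : ℂ) 1, ‖(p : ℂ)‖ < 1 := fun p => mem_ball_zero_iff.1 p.2
  have hv : Continuous fun p : Metric.ball (0 : ℂ) 1 => (p : ℂ) := continuous_subtype_val
  have hP : ∀ u : ℂ, Continuous fun p : Metric.ball (0 : ℂ) 1 => qPochInf u p := fun u =>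
    Continuous.qPochInf_comp continuous_const hv hq1
  have hc1 : Continuous fun p : Metric.ball (0 : ℂ) 1 =>
      awIntegral p a b c d * (qPochInf p p * (qPochInf (a * b) p * qPochInf (a * c) p *
      qPochInf (a * d) p * (qPochInf (b * c) p * qPochInf (b * d) p) * qPochInf (c * d) p)) :=
    (continuous_awIntegral hv continuous_const continuous_const continuous_const continuous_const
      hq1 (fun _ => ha) (fun _ => hb) (fun _ => hc) (fun _ => hd)).mul
    ((Continuous.qPochInf_comp hv hv hq1).mul (((((hP _).mul (hP _)).mul (hP _)).mul
      ((hP _).mul (hP _))).mul (hP _)))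
  have hc2 : Continuous fun p : Metric.ball (0 : ℂ) 1 =>
      2 * (2 * Real.pi * Complex.I) * qPochInf (a * b * c * d) p := continuous_const.mul (hP _)
  rcases eq_or_ne q 0 with rfl | hq0
  -- Both sides are continuous in the base on the open disc, so q = 0 is reached along the nonzero
  -- bases 2^{−(n+1)}.
  · obtain ⟨x, hx0, hx⟩ : ∃ x : ℕ → Metric.ball (0 : ℂ) 1, (∀ n, (x n : ℂ) ≠ 0) ∧
        Tendsto x atTop (𝓝 ⟨0, by simp⟩) := by
      have hh : ‖(1 / 2 : ℂ)‖ < 1 := by norm_num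
      refine ⟨fun n => ⟨(1 / 2) ^ (n + 1), ?_⟩, fun n => pow_ne_zero _ (by norm_num), ?_⟩
      · rw [mem_ball_zero_iff, norm_pow]
        exact pow_lt_one₀ (norm_nonneg _) hh n.succ_ne_zero
      · exact tendsto_subtype_rng.2
          ((tendsto_pow_atTop_nhds_zero_of_norm_lt_one hh).comp (tendsto_add_atTop_nat 1))
    have h1 := (hc1.tendsto ⟨0, by simp⟩).comp hx
    have h2 := (hc2.tendsto ⟨0, by simp⟩).comp hx
    exact tendsto_nhds_unique_of_eventuallyEq h1 h2 (Eventually.of_forall fun n =>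
      awIntegral_eval_of_ne_zero (hq1 (x n)) ha hb hc hd (hx0 n))
  · exact awIntegral_eval_of_ne_zero hq ha hb hc hd hq0

theorem askeyWilsonIntegral_eval {q : ℂ} (hq : ‖q‖ < 1) (a : Fin 4 → ℂ) (ha : ∀ j, ‖a j‖ < 1) :
    askeyWilsonIntegral q a =
      2 * qPochInf (∏ j, a j) q /
        (qPochInf q q * ∏ i, ∏ j ∈ Finset.Ioi i, qPochInf (a i * a j) q) := by
  have h := awIntegral_eval hq (ha 0) (ha 1) (ha 2) (ha 3)
  have hne : qPochInf q q * ∏ i, ∏ j ∈ Finset.Ioi i, qPochInf (a i * a j) q ≠ 0 :=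
    mul_ne_zero (qPochInf_self_ne_zero hq) (Finset.prod_ne_zero_iff.2 fun i _ =>
      Finset.prod_ne_zero_iff.2 fun j _ => qPochInf_ne_zero hq (norm_mul_lt_one (ha i) (ha j)))
  have i0 : Finset.Ioi (0 : Fin 4) = {1, 2, 3} := by decide
  have i1 : Finset.Ioi (1 : Fin 4) = {2, 3} := by decide
  have i2 : Finset.Ioi (2 : Fin 4) = {3} := by decide
  have i3 : Finset.Ioi (3 : Fin 4) = ∅ := by decide
  have hpi : 2 * (Real.pi : ℂ) * Complex.I ≠ 0 := Complex.two_pi_I_ne_zero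
  rw [eq_div_iff hne, askeyWilsonIntegral_eq, mul_assoc, inv_mul_eq_iff_eq_mul₀ hpi]
  simp only [Fin.prod_univ_four, i0, i1, i2, i3, Finset.prod_empty, Finset.prod_singleton]
  rw [Finset.prod_insert (by decide), Finset.prod_insert (by decide),
    Finset.prod_insert (by decide), Finset.prod_singleton, Finset.prod_singleton]
  linear_combination h

/-! ### Jackson's bilateral sum at z = a₁ (`a 0` in the code) -/

theorem qPow_add (τ u v : ℂ) : qPow τ (u + v) = qPow τ u * qPow τ v := by
  rw [qPow, qPow, qPow, mul_add, Complex.exp_add]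

theorem qPow_sub (τ u v : ℂ) : qPow τ (u - v) = qPow τ u / qPow τ v := by
  rw [qPow, qPow, qPow, mul_sub, Complex.exp_sub]

theorem qPow_ne_zero (τ u : ℂ) : qPow τ u ≠ 0 := Complex.exp_ne_zero _

theorem qPow_intCast (τ : ℂ) (n : ℤ) : qPow τ n = Complex.exp τ ^ n := by
  rw [qPow, mul_comm, Complex.exp_int_mul]

theorem qPow_natCast_mul (τ u : ℂ) (n : ℕ) : qPow τ (n * u) = qPow τ u ^ n := by
  rw [qPow, qPow, mul_left_comm, Complex.exp_nat_mul]

theorem qPow_sum {ι : Type*} (τ : ℂ) (t : Finset ι) (f : ι → ℂ) :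
    qPow τ (∑ i ∈ t, f i) = ∏ i ∈ t, qPow τ (f i) := by
  simp only [qPow, Finset.mul_sum, Complex.exp_sum]

/-- This quotient is the very-well-poised part of the series: the products in ±qx and ±x telescope
against each other. -/
theorem qPoch_mul_base_mul_neg {q x : ℂ} (hx : ∀ k : ℕ, x ^ 2 * q ^ (2 * k) ≠ 1) (n : ℕ) :
    qPoch (q * x) q n * qPoch (-(q * x)) q n / (qPoch x q n * qPoch (-x) q n) =
      (1 - x ^ 2 * q ^ (2 * n)) / (1 - x ^ 2) := by
  have h1 : ∀ k : ℕ, x * q ^ k ≠ 1 := fun k h => hx k (by rw [pow_mul', ← mul_pow, h, one_pow])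
  have h2 : ∀ k : ℕ, -x * q ^ k ≠ 1 := fun k h => hx k (by
    rw [pow_mul', ← mul_pow, ← neg_sq (x * q ^ k), ← neg_mul, h, one_pow])
  have h3 : 1 - x ^ 2 ≠ 0 := fun h => hx 0 (by simpa using (sub_eq_zero.1 h).symm)
  have e1 : (1 - x) * qPoch (q * x) q n = qPoch x q n * (1 - x * q ^ n) := by
    rw [mul_comm q x, ← qPoch_succ', qPoch_succ]
  have e2 : (1 + x) * qPoch (-(q * x)) q n = qPoch (-x) q n * (1 + x * q ^ n) := by
    have := (qPoch_succ' (-x) q n).symm.trans (qPoch_succ (-x) q n)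
    rw [show -x * q = -(q * x) by ring] at this
    linear_combination this
  rw [div_eq_div_iff (mul_ne_zero (qPoch_ne_zero h1 n) (qPoch_ne_zero h2 n)) h3]
  calc _ = ((1 - x) * qPoch (q * x) q n) * ((1 + x) * qPoch (-(q * x)) q n) := by ring
    _ = _ := by rw [e1, e2, pow_mul']; ring

theorem basicHyp_term_eq_vwpTerm {q x b c d : ℂ} (hx : ∀ k : ℕ, x ^ 2 * q ^ (2 * k) ≠ 1)
    (hb : b ≠ 0) (hc : c ≠ 0) (hd : d ≠ 0) (n : ℕ) :
    (∏ i, qPoch (![q * x, -(q * x), x ^ 2, b, c, d] i) q n) /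
        (qPoch q q n * ∏ i, qPoch (![x, -x, x ^ 2 * q / b, x ^ 2 * q / c, x ^ 2 * q / d] i) q n) *
        (x ^ 2 * q / (b * c * d)) ^ n = vwpTerm (x ^ 2) b c q d⁻¹ n := by
  have h1 := qPoch_mul_base_mul_neg hx n
  rw [vwpTerm, ← h1, ← qPoch_mul_inv_pow hd, Fin.prod_univ_six, Fin.prod_univ_five,
    show x ^ 2 * q / (b * c * d) = x ^ 2 * q / (b * c) * d⁻¹ by field_simp, mul_pow]
  simp only [Matrix.cons_val, div_eq_mul_inv, mul_inv]
  ring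

section

variable {q : ℂ} (hq : ‖q‖ < 1) {a : Fin 4 → ℂ} (ha : ∀ j, ‖a j‖ < 1) (hA : ‖q‖ < ‖∏ j, a j‖)

include hA

theorem param_ne_zero (j : Fin 4) : a j ≠ 0 := by
  have h : ∏ j, a j ≠ 0 := norm_pos_iff.1 ((norm_nonneg q).trans_lt hA)
  exact Finset.prod_ne_zero_iff.1 h j (Finset.mem_univ j)

theorem jacksonQ_add_negSucc {τ : ℂ} {s : Fin 4 → ℂ} (hq : ‖q‖ < 1)
    (hτ : Complex.exp τ = q) (hs : ∀ j, qPow τ (s j) = a j) (m : ℕ) :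
    jacksonQ τ s (s 0 + (Int.negSucc m : ℤ)) = 0 := by
  have hq0 : q ≠ 0 := hτ ▸ Complex.exp_ne_zero τ
  have ha0 := param_ne_zero hA 0
  have hz : qPochInf (Complex.exp τ * (qPow τ (s 0))⁻¹ * qPow τ (s 0 + (Int.negSucc m : ℤ)))
      (Complex.exp τ) = 0 := by
    rw [qPow_add, qPow_intCast, hs, hτ, qPochInf_eq_zero_iff hq]
    -- At z = a₁q^{−m−1} the argument of the symbol is q^{−m}, so the factor with index m vanishes.
    refine ⟨m, ?_⟩
    rw [zpow_negSucc, pow_succ']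
    field_simp
  rw [jacksonQ, Finset.prod_eq_zero (Finset.mem_univ 0), mul_zero]
  rw [hz, zero_div, mul_zero]

theorem jacksonQ_eq_zero_of_notMem_range {τ : ℂ} {s : Fin 4 → ℂ} (hq : ‖q‖ < 1)
    (hτ : Complex.exp τ = q) (hs : ∀ j, qPow τ (s j) = a j) (ν : ℤ)
    (hν : ν ∉ Set.range ((↑) : ℕ → ℤ)) :
    jacksonQ τ s (s 0 + (ν : ℂ)) = 0 := by
  obtain ⟨m, rfl⟩ : ∃ m : ℕ, ν = Int.negSucc m := by
    rcases ν with n | m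
    · exact absurd ⟨n, rfl⟩ hν
    · exact ⟨m, rfl⟩
  exact jacksonQ_add_negSucc hA hq hτ hs m

include ha

theorem norm_base_lt_param (j : Fin 4) : ‖q‖ < ‖a j‖ := by
  refine hA.trans_le ?_
  rw [norm_prod, ← Finset.mul_prod_erase _ _ (Finset.mem_univ j)]
  exact mul_le_of_le_one_right (norm_nonneg _)
    (Finset.prod_le_one (fun _ _ => norm_nonneg _) fun i _ => (ha i).le)

theorem norm_base_lt_param_mul {i j : Fin 4} (hij : i ≠ j) : ‖q‖ < ‖a i * a j‖ := by
  refine hA.trans_le ?_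
  rw [norm_prod, ← Finset.mul_prod_erase _ _ (Finset.mem_univ i),
    ← Finset.mul_prod_erase _ _ (Finset.mem_erase.2 ⟨hij.symm, Finset.mem_univ j⟩), ← mul_assoc,
    ← norm_mul]
  exact mul_le_of_le_one_right (norm_nonneg _)
    (Finset.prod_le_one (fun _ _ => norm_nonneg _) fun i _ => (ha i).le)

theorem qPochInf_div_param_ne_zero (hq : ‖q‖ < 1) {i j : Fin 4} (hij : i ≠ j) :
    qPochInf (q * (a i)⁻¹ * (a j)⁻¹) q ≠ 0 := by
  have h := norm_base_lt_param_mul ha hA hij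
  refine qPochInf_ne_zero hq ?_
  rwa [mul_assoc, ← mul_inv, norm_mul, norm_inv, ← div_eq_mul_inv,
    div_lt_one ((norm_nonneg q).trans_lt h)]

theorem norm_param_div_lt (i j : Fin 4) : ‖q * a i * (a j)⁻¹‖ < 1 := by
  have h := norm_base_lt_param ha hA j
  rw [mul_right_comm, norm_mul, norm_mul, norm_inv]
  refine (mul_le_of_le_one_right (by positivity) (ha i).le).trans_lt ?_
  rwa [← div_eq_mul_inv, div_lt_one ((norm_nonneg q).trans_lt h)]

/-- A zero would mean a₁² = q^{k+1}. The case k = 0 is excluded by hypothesis; k ≥ 1 gives |a₁| ≤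
|q|, against |q| < |a₁|. -/
theorem qPochInf_inv_sq_ne_zero (hq : ‖q‖ < 1) (h0 : a 0 ^ 2 ≠ q) :
    qPochInf (q * (a 0 ^ 2)⁻¹) q ≠ 0 := by
  rw [Ne, qPochInf_eq_zero_iff hq]
  rintro ⟨k, hk⟩
  have hne := param_ne_zero hA 0
  have hlt := norm_base_lt_param ha hA 0
  have h1 : a 0 ^ 2 = q * q ^ k := by
    have h : a 0 ^ 2 * (q * (a 0 ^ 2)⁻¹ * q ^ k) = q * q ^ k := by field_simp
    rwa [hk, mul_one] at h
  rcases Nat.eq_zero_or_pos k with rfl | hk0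
  · exact h0 (by simpa using h1)
  · have h2 : ‖a 0‖ ^ 2 = ‖q‖ * ‖q‖ ^ k := by rw [← norm_pow, h1, norm_mul, norm_pow]
    have h3 : ‖q‖ ^ k ≤ ‖q‖ := pow_le_of_le_one (norm_nonneg q) hq.le hk0.ne'
    nlinarith [norm_nonneg q]

theorem jacksonH_ne_zero (hq : ‖q‖ < 1) (h0 : a 0 ^ 2 ≠ q) {τ : ℂ} {s : Fin 4 → ℂ}
    (hτ : Complex.exp τ = q) (hs : ∀ j, qPow τ (s j) = a j) : jacksonH τ s (s 0) ≠ 0 := by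
  have hp : ∀ i j : Fin 4, qPochInf (a i * a j) q ≠ 0 := fun i j =>
    qPochInf_ne_zero hq (norm_mul_lt_one (ha i) (ha j))
  have h1 := qPochInf_inv_sq_ne_zero ha hA hq h0
  rw [jacksonH, hτ, hs]
  refine mul_ne_zero (qPow_ne_zero _ _) (div_ne_zero (mul_ne_zero ?_ h1)
    (Finset.prod_ne_zero_iff.2 fun j _ => ?_))
  · rw [pow_two]; exact hp 0 0
  · rw [hs, qTheta]
    refine mul_ne_zero (hp j 0) ?_
    rcases eq_or_ne j 0 with rfl | hj
    · rwa [← pow_two]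
    · rw [mul_inv, ← mul_assoc]
      exact qPochInf_div_param_ne_zero ha hA hq hj

/-- Each symbol at a₁qⁿ is the symbol at a₁ divided by a finite symbol. The parts independent of n
assemble into h(a₁) times the prefactor; the finite symbols and powers form the ₆φ₅ term with
parameters a₁²; a₁a₂, a₁a₃, a₁a₄. -/
theorem jacksonQ_add_natCast {τ : ℂ} {s : Fin 4 → ℂ} (hq : ‖q‖ < 1) (h0 : a 0 ^ 2 ≠ q)
    (hτ : Complex.exp τ = q) (hs : ∀ j, qPow τ (s j) = a j) (n : ℕ) :
    jacksonQ τ s (s 0 + ((n : ℤ) : ℂ)) = jacksonH τ s (s 0) *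
      ((∏ i, (qPochInf (q * a 0 * (a i)⁻¹) q * qPochInf (q * (a 0)⁻¹ * (a i)⁻¹) q)) /
        (qPochInf (q * a 0 ^ 2) q * qPochInf (q * (a 0 ^ 2)⁻¹) q)) *
      vwpTerm (a 0 ^ 2) (a 0 * a 1) (a 0 * a 2) q (a 0 * a 3)⁻¹ n := by
  have hq0 : q ≠ 0 := hτ ▸ Complex.exp_ne_zero τ
  have hne := param_ne_zero hA
  have hQ : ∀ j, qPochInf (q * (a j)⁻¹ * (a 0 * q ^ n)) q / qPochInf (a j * (a 0 * q ^ n)) q =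
      qPochInf (q * a 0 * (a j)⁻¹) q / qPochInf (a j * a 0) q *
      (qPoch (a 0 * a j) q n / qPoch (q * a 0 * (a j)⁻¹) q n) := fun j => by
    have e1 := qPochInf_eq_qPoch_mul hq (q * a 0 * (a j)⁻¹) n
    have e2 := qPochInf_eq_qPoch_mul hq (a j * a 0) n
    have n1 := qPochInf_ne_zero hq (norm_param_div_lt ha hA 0 j)
    have n2 := qPochInf_ne_zero hq (norm_mul_lt_one (ha j) (ha 0))
    rw [e1] at n1 ⊢
    rw [e2] at n2 ⊢
    rw [show q * (a j)⁻¹ * (a 0 * q ^ n) = q * a 0 * (a j)⁻¹ * q ^ n by ring, ← mul_assoc (a j),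
      mul_comm (a 0) (a j)]
    have := left_ne_zero_of_mul n1
    have := right_ne_zero_of_mul n2
    have := left_ne_zero_of_mul n2
    generalize qPoch (q * a 0 * (a j)⁻¹) q n = Y1 at *
    generalize qPochInf (q * a 0 * (a j)⁻¹ * q ^ n) q = Y2 at *
    generalize qPoch (a j * a 0) q n = Y3 at *
    generalize qPochInf (a j * a 0 * q ^ n) q = Y4 at *
    field_simp
  -- The exponents 1/2 − s_j add up to 2 − Σs_j, one more than in h. The extra factor z = a₁qⁿ
  -- combines with z⁻¹ − z into the well-poised factor 1 − a₁²q^{2n}; the rest yields (q/∏a_j)ⁿ.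
  have hpow : ∏ j, qPow τ ((s 0 + ((n : ℤ) : ℂ)) * (1 / 2 - s j)) =
      qPow τ (s 0 * (1 - ∑ j, s j)) * (a 0 * (q ^ n * (q / ∏ j, a j) ^ n)) := by
    have e : ∑ j : Fin 4, (s 0 + ((n : ℤ) : ℂ)) * (1 / 2 - s j) =
        s 0 * (1 - ∑ j, s j) + (s 0 + ((n : ℤ) + n * (((1 : ℤ) : ℂ) - ∑ j, s j))) := by
      rw [← Finset.mul_sum, Finset.sum_sub_distrib]
      simp
      ring
    rw [← qPow_sum, e, qPow_add, qPow_add, qPow_add, qPow_natCast_mul, qPow_sub, qPow_sum,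
      qPow_intCast, qPow_intCast, hτ, hs, zpow_natCast, zpow_one]
    simp only [hs]
  have hz : qPow τ (s 0 + ((n : ℤ) : ℂ)) = a 0 * q ^ n := by
    rw [qPow_add, qPow_intCast, hs, hτ, zpow_natCast]
  have hsq : qPochInf (a 0 ^ 2) q = (1 - a 0 ^ 2) * qPochInf (q * a 0 ^ 2) q := by
    rw [qPochInf_eq_one_sub_mul hq, mul_comm _ q]
  have hnsq : qPochInf (a 0 ^ 2) q ≠ 0 := by
    rw [pow_two]; exact qPochInf_ne_zero hq (norm_mul_lt_one (ha 0) (ha 0))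
  have hinv := qPochInf_inv_sq_ne_zero ha hA hq h0
  have hth : ∀ j, qTheta (a j * a 0) q =
      qPochInf (a j * a 0) q * qPochInf (q * (a 0)⁻¹ * (a j)⁻¹) q := fun j => by
    rw [qTheta, mul_inv_rev, mul_assoc]
  have hn0 : ∀ j, qPochInf (a j * a 0) q ≠ 0 := fun j =>
    qPochInf_ne_zero hq (norm_mul_lt_one (ha j) (ha 0))
  have hn1 : ∀ j, qPochInf (q * (a 0)⁻¹ * (a j)⁻¹) q ≠ 0 := fun j => by
    rcases eq_or_ne j 0 with rfl | hj
    · rwa [mul_assoc, ← mul_inv, ← pow_two]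
    · exact qPochInf_div_param_ne_zero ha hA hq hj.symm
  have hterm : (1 - a 0 ^ 2) * vwpTerm (a 0 ^ 2) (a 0 * a 1) (a 0 * a 2) q (a 0 * a 3)⁻¹ n =
      (1 - a 0 ^ 2 * q ^ (2 * n)) * (q / ∏ j, a j) ^ n *
      ∏ j, (qPoch (a 0 * a j) q n / qPoch (q * a 0 * (a j)⁻¹) q n) := by
    have h1 : 1 - a 0 ^ 2 ≠ 0 := left_ne_zero_of_mul (hsq ▸ hnsq)
    have ha0 := hne 0
    have ha1 := hne 1
    have ha2 := hne 2
    have ha3 := hne 3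
    rw [vwpTerm, ← qPoch_mul_inv_pow (mul_ne_zero ha0 ha3), Fin.prod_univ_four, Fin.prod_univ_four,
      show a 0 ^ 2 * q / (a 0 * a 1) = q * a 0 * (a 1)⁻¹ by field_simp,
      show a 0 ^ 2 * q / (a 0 * a 2) = q * a 0 * (a 2)⁻¹ by field_simp,
      show a 0 ^ 2 * q * (a 0 * a 3)⁻¹ = q * a 0 * (a 3)⁻¹ by field_simp,
      show q / (a 0 * a 1 * a 2 * a 3) = (a 0 * a 3)⁻¹ * (a 0 ^ 2 * q / (a 0 * a 1 * (a 0 * a 2))) by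
        field_simp, mul_pow, show a 0 * a 0 = a 0 ^ 2 by ring,
      show q * a 0 * (a 0)⁻¹ = q by field_simp]
    simp only [div_eq_mul_inv, mul_inv]
    have h2 : (1 - a 0 ^ 2) * (1 - a 0 ^ 2)⁻¹ = 1 := mul_inv_cancel₀ h1
    linear_combination ((1 - a 0 ^ 2 * q ^ (2 * n)) * (qPoch (a 0 ^ 2) q n * qPoch (a 0 * a 1) q n *
      qPoch (a 0 * a 2) q n * (qPoch (a 0 * a 3) q n * (a 0 * a 3)⁻¹ ^ n)) *
      ((qPoch q q n)⁻¹ * (qPoch (q * a 0 * (a 1)⁻¹) q n)⁻¹ * (qPoch (q * a 0 * (a 2)⁻¹) q n)⁻¹ *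
      (qPoch (q * a 0 * (a 3)⁻¹) q n)⁻¹) * (a 0 ^ 2 * q * ((a 0 * a 1)⁻¹ * (a 0 * a 2)⁻¹)) ^ n) * h2
  rw [jacksonQ, Finset.prod_mul_distrib, hpow, hz, jacksonH, hτ]
  simp only [hs, hQ, hth, Finset.prod_mul_distrib, Finset.prod_div_distrib] at hterm ⊢
  have hP0 := Finset.prod_ne_zero_iff.2 fun j (_ : j ∈ Finset.univ) => hn0 j
  have hP1 := Finset.prod_ne_zero_iff.2 fun j (_ : j ∈ Finset.univ) => hn1 j
  have h1 : 1 - a 0 ^ 2 ≠ 0 := left_ne_zero_of_mul (hsq ▸ hnsq)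
  have h2 : qPochInf (q * a 0 ^ 2) q ≠ 0 := right_ne_zero_of_mul (hsq ▸ hnsq)
  rw [eq_div_of_mul_eq h1 ((mul_comm _ _).trans hterm), qTheta, hsq]
  generalize (∏ j, qPochInf (a j * a 0) q) = X0 at *
  generalize (∏ j, qPochInf (q * (a 0)⁻¹ * (a j)⁻¹) q) = X1 at *
  generalize (∏ j, qPochInf (q * a 0 * (a j)⁻¹) q) = X2 at *
  generalize (∏ j, qPoch (a 0 * a j) q n) / (∏ j, qPoch (q * a 0 * (a j)⁻¹) q n) = X3 at *
  generalize (q / ∏ j, a j) ^ n = X4 at *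
  generalize qPow τ (s 0 * (1 - ∑ j, s j)) = X5 at *
  generalize qPochInf (q * a 0 ^ 2) q = X6 at *
  generalize qPochInf (q * (a 0 ^ 2)⁻¹) q = X7 at *
  have ha0 := hne 0
  field_simp
  ring

end

section

variable {q : ℂ} (hq : ‖q‖ < 1) {a : Fin 4 → ℂ} (ha : ∀ j, ‖a j‖ < 1) (hA : ‖q‖ < ‖∏ j, a j‖)

include hq ha

theorem sq_param_mul_pow_ne_one (k : ℕ) : a 0 ^ 2 * q ^ k ≠ 1 := by
  refine fun h => absurd ((qPochInf_eq_zero_iff hq _).2 ⟨k, h⟩) (qPochInf_ne_zero hq ?_)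
  rw [pow_two]
  exact norm_mul_lt_one (ha 0) (ha 0)

include hA

theorem base_mul_param_div_mul_pow_ne_one (j : Fin 4) (k : ℕ) : q * a 0 * (a j)⁻¹ * q ^ k ≠ 1 :=
  fun h => absurd ((qPochInf_eq_zero_iff hq _).2 ⟨k, h⟩)
    (qPochInf_ne_zero hq (norm_param_div_lt ha hA 0 j))

theorem vwpTerm_param_hypotheses :
    (∀ k : ℕ, a 0 ^ 2 * q / (a 0 * a 1) * q ^ k ≠ 1) ∧
      (∀ k : ℕ, a 0 ^ 2 * q / (a 0 * a 2) * q ^ k ≠ 1) ∧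
      (∀ k : ℕ, a 0 ^ 2 * q * (a 0 * a 3)⁻¹ * q ^ k ≠ 1) ∧
      ‖a 0 ^ 2 * q / (a 0 * a 1 * (a 0 * a 2)) * (a 0 * a 3)⁻¹‖ < 1 := by
  have hne := param_ne_zero hA
  have ha0 := hne 0
  have ha1 := hne 1
  have ha2 := hne 2
  have ha3 := hne 3
  have h := base_mul_param_div_mul_pow_ne_one hq ha hA
  refine ⟨fun k => ?_, fun k => ?_, fun k => ?_, ?_⟩
  · rw [show a 0 ^ 2 * q / (a 0 * a 1) = q * a 0 * (a 1)⁻¹ by field_simp]; exact h 1 k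
  · rw [show a 0 ^ 2 * q / (a 0 * a 2) = q * a 0 * (a 2)⁻¹ by field_simp]; exact h 2 k
  · rw [show a 0 ^ 2 * q * (a 0 * a 3)⁻¹ = q * a 0 * (a 3)⁻¹ by field_simp]; exact h 3 k
  · rw [show a 0 ^ 2 * q / (a 0 * a 1 * (a 0 * a 2)) * (a 0 * a 3)⁻¹ = q / ∏ j, a j by
      rw [Fin.prod_univ_four]; field_simp, norm_div, div_lt_one ((norm_nonneg q).trans_lt hA)]
    exact hA

theorem summable_vwpTerm_param :
    Summable (vwpTerm (a 0 ^ 2) (a 0 * a 1) (a 0 * a 2) q (a 0 * a 3)⁻¹) := by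
  obtain ⟨h1, h2, h3, h4⟩ := vwpTerm_param_hypotheses hq ha hA
  exact summable_vwpTerm hq h1 h2 h3
    (inv_ne_zero (mul_ne_zero (param_ne_zero hA 0) (param_ne_zero hA 3))) h4

theorem basicHyp_eq_tsum_vwpTerm :
    basicHyp (r := 5) ![q * a 0, -(q * a 0), a 0 ^ 2, a 0 * a 1, a 0 * a 2, a 0 * a 3]
        ![a 0, -a 0, q * a 0 / a 1, q * a 0 / a 2, q * a 0 / a 3] q (q / ∏ j, a j) =
      ∑' n, vwpTerm (a 0 ^ 2) (a 0 * a 1) (a 0 * a 2) q (a 0 * a 3)⁻¹ n := by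
  have hne := param_ne_zero hA
  have ha0 := hne 0
  have ha1 := hne 1
  have ha2 := hne 2
  have ha3 := hne 3
  rw [basicHyp]
  refine tsum_congr fun n => ?_
  rw [← basicHyp_term_eq_vwpTerm (fun k => sq_param_mul_pow_ne_one hq ha _) (mul_ne_zero ha0 ha1)
    (mul_ne_zero ha0 ha2) (mul_ne_zero ha0 ha3),
    show a 0 ^ 2 * q / (a 0 * a 1) = q * a 0 / a 1 by field_simp,
    show a 0 ^ 2 * q / (a 0 * a 2) = q * a 0 / a 2 by field_simp,
    show a 0 ^ 2 * q / (a 0 * a 3) = q * a 0 / a 3 by field_simp,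
    show a 0 ^ 2 * q / (a 0 * a 1 * (a 0 * a 2) * (a 0 * a 3)) = q / ∏ j, a j by
      rw [Fin.prod_univ_four]; field_simp]

theorem prefactor_mul_tsum_vwpTerm (h0 : a 0 ^ 2 ≠ q) :
    (∏ i, (qPochInf (q * a 0 * (a i)⁻¹) q * qPochInf (q * (a 0)⁻¹ * (a i)⁻¹) q)) /
        (qPochInf (q * a 0 ^ 2) q * qPochInf (q * (a 0 ^ 2)⁻¹) q) *
      ∑' n, vwpTerm (a 0 ^ 2) (a 0 * a 1) (a 0 * a 2) q (a 0 * a 3)⁻¹ n =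
      qPochInf q q * (∏ i, ∏ j ∈ Finset.Ioi i, qPochInf (q * (a i)⁻¹ * (a j)⁻¹) q) /
        qPochInf (q * (∏ j, a j)⁻¹) q := by
  have hne := param_ne_zero hA
  have ha0 := hne 0
  have ha1 := hne 1
  have ha2 := hne 2
  have ha3 := hne 3
  obtain ⟨h1, h2, h3, h4⟩ := vwpTerm_param_hypotheses hq ha hA
  -- Needed because the ₆φ₅ sum passes through t = 1. It amounts to |q| < |a₂a₃|, which holds since
  -- the other two parameters have modulus below 1.
  have hbc : ‖a 0 ^ 2 * q / (a 0 * a 1 * (a 0 * a 2))‖ < 1 := by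
    rw [show a 0 ^ 2 * q / (a 0 * a 1 * (a 0 * a 2)) = q / (a 1 * a 2) by field_simp, norm_div]
    have h := norm_base_lt_param_mul ha hA (i := 1) (j := 2) (by decide)
    rwa [div_lt_one ((norm_nonneg q).trans_lt h)]
  have key := tsum_vwpTerm hq (sq_param_mul_pow_ne_one hq ha) (mul_ne_zero ha0 ha1)
    (mul_ne_zero ha0 ha2) h1 h2 h3 (inv_ne_zero (mul_ne_zero ha0 ha3)) h4 hbc
  have n1 : qPochInf (q * a 0 ^ 2) q ≠ 0 := by
    rw [pow_two]
    exact qPochInf_ne_zero hq (norm_mul_lt_one hq (norm_mul_lt_one (ha 0) (ha 0)))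
  have n2 := qPochInf_inv_sq_ne_zero ha hA hq h0
  have n3 : qPochInf (q * (∏ j, a j)⁻¹) q ≠ 0 := by
    refine qPochInf_ne_zero hq ?_
    rwa [norm_mul, norm_inv, ← div_eq_mul_inv, div_lt_one ((norm_nonneg q).trans_lt hA)]
  have i0 : Finset.Ioi (0 : Fin 4) = {1, 2, 3} := by decide
  have i1 : Finset.Ioi (1 : Fin 4) = {2, 3} := by decide
  have i2 : Finset.Ioi (2 : Fin 4) = {3} := by decide
  have i3 : Finset.Ioi (3 : Fin 4) = ∅ := by decide
  rw [div_mul_eq_mul_div, div_eq_div_iff (mul_ne_zero n1 n2) n3]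
  simp only [Fin.prod_univ_four, i0, i1, i2, i3, Finset.prod_empty, Finset.prod_singleton]
  rw [Finset.prod_insert (by decide), Finset.prod_insert (by decide),
    Finset.prod_insert (by decide), Finset.prod_singleton, Finset.prod_singleton]
  rw [show a 0 ^ 2 * q * (a 0 * a 3)⁻¹ / (a 0 * a 1 * (a 0 * a 2)) = q * (a 0 * a 1 * a 2 * a 3)⁻¹ by
      field_simp,
    show a 0 ^ 2 * q * (a 0 * a 3)⁻¹ / (a 0 * a 1) = q * (a 1)⁻¹ * (a 3)⁻¹ by field_simp,
    show a 0 ^ 2 * q * (a 0 * a 3)⁻¹ / (a 0 * a 2) = q * (a 2)⁻¹ * (a 3)⁻¹ by field_simp,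
    show a 0 ^ 2 * q * (a 0 * a 3)⁻¹ = q * a 0 * (a 3)⁻¹ by field_simp,
    show a 0 ^ 2 * q / (a 0 * a 1 * (a 0 * a 2)) = q * (a 1)⁻¹ * (a 2)⁻¹ by field_simp,
    show a 0 ^ 2 * q / (a 0 * a 1) = q * a 0 * (a 1)⁻¹ by field_simp,
    show a 0 ^ 2 * q / (a 0 * a 2) = q * a 0 * (a 2)⁻¹ by field_simp, mul_comm (a 0 ^ 2) q] at key
  -- The factor i = 0 of the prefactor becomes (q;q)_∞(q/a₁²;q)_∞: the first part appears in the
  -- product formula, the second cancels the denominator.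
  rw [show q * a 0 * (a 0)⁻¹ = q by field_simp,
    show q * (a 0)⁻¹ * (a 0)⁻¹ = q * (a 0 ^ 2)⁻¹ by field_simp]
  linear_combination (qPochInf q q * qPochInf (q * (a 0 ^ 2)⁻¹) q *
    (qPochInf (q * (a 0)⁻¹ * (a 1)⁻¹) q * qPochInf (q * (a 0)⁻¹ * (a 2)⁻¹) q *
      qPochInf (q * (a 0)⁻¹ * (a 3)⁻¹) q)) * key

variable {τ : ℂ} {s : Fin 4 → ℂ} (hτ : Complex.exp τ = q) (hs : ∀ j, qPow τ (s j) = a j)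
  (h0 : a 0 ^ 2 ≠ q)

include hτ hs h0

/-- Terms with negative index vanish, so summability over ℤ is that of the ₆φ₅ series over ℕ. -/
theorem summable_jacksonQ : Summable fun ν : ℤ => jacksonQ τ s (s 0 + (ν : ℂ)) := by
  refine (Function.Injective.summable_iff (Nat.cast_injective (R := ℤ))
    (jacksonQ_eq_zero_of_notMem_range hA hq hτ hs)).1 ?_
  refine ((summable_vwpTerm_param hq ha hA).mul_left (jacksonH τ s (s 0) *
      ((∏ i, (qPochInf (q * a 0 * (a i)⁻¹) q * qPochInf (q * (a 0)⁻¹ * (a i)⁻¹) q)) /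
        (qPochInf (q * a 0 ^ 2) q * qPochInf (q * (a 0 ^ 2)⁻¹) q)))).congr fun n => ?_
  exact (jacksonQ_add_natCast ha hA hq h0 hτ hs n).symm

theorem jacksonReg_eq : jacksonReg τ s (s 0) =
    (∏ i, (qPochInf (q * a 0 * (a i)⁻¹) q * qPochInf (q * (a 0)⁻¹ * (a i)⁻¹) q)) /
        (qPochInf (q * a 0 ^ 2) q * qPochInf (q * (a 0 ^ 2)⁻¹) q) *
      ∑' n, vwpTerm (a 0 ^ 2) (a 0 * a 1) (a 0 * a 2) q (a 0 * a 3)⁻¹ n := by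
  have hsupp : Function.support (fun ν : ℤ => jacksonQ τ s (s 0 + (ν : ℂ))) ⊆
      Set.range ((↑) : ℕ → ℤ) := fun ν hν => by
    by_contra h
    exact hν (jacksonQ_eq_zero_of_notMem_range hA hq hτ hs ν h)
  rw [jacksonReg, jacksonJ, ← Function.Injective.tsum_eq (Nat.cast_injective (R := ℤ)) hsupp,
    tsum_congr (jacksonQ_add_natCast ha hA hq h0 hτ hs), tsum_mul_left, mul_assoc,
    mul_div_cancel_left₀ _ (jacksonH_ne_zero ha hA hq h0 hτ hs)]

theorem jacksonReg_eq_prod : jacksonReg τ s (s 0) =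
    qPochInf q q * (∏ i, ∏ j ∈ Finset.Ioi i, qPochInf (q * (a i)⁻¹ * (a j)⁻¹) q) /
      qPochInf (q * (∏ j, a j)⁻¹) q := by
  rw [jacksonReg_eq hq ha hA hτ hs h0, prefactor_mul_tsum_vwpTerm hq ha hA h0]

/-- Both sides are already known as products; splitting each theta into its two symbols makes the
second ones cancel against the product for `jacksonReg`. -/
theorem askeyWilsonIntegral_eq_jacksonReg : askeyWilsonIntegral q a =
    2 * qTheta (∏ j, a j) q / (qPochInf q q ^ 2 * ∏ i, ∏ j ∈ Finset.Ioi i, qTheta (a i * a j) q) *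
      jacksonReg τ s (s 0) := by
  have hth : ∀ i j, qTheta (a i * a j) q =
      qPochInf (a i * a j) q * qPochInf (q * (a i)⁻¹ * (a j)⁻¹) q := fun i j => by
    rw [qTheta, mul_inv, mul_assoc]
  have n1 : ∏ i, ∏ j ∈ Finset.Ioi i, qPochInf (a i * a j) q ≠ 0 :=
    Finset.prod_ne_zero_iff.2 fun i _ => Finset.prod_ne_zero_iff.2 fun j _ =>
      qPochInf_ne_zero hq (norm_mul_lt_one (ha i) (ha j))
  have n2 : ∏ i, ∏ j ∈ Finset.Ioi i, qPochInf (q * (a i)⁻¹ * (a j)⁻¹) q ≠ 0 :=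
    Finset.prod_ne_zero_iff.2 fun i _ => Finset.prod_ne_zero_iff.2 fun j hj =>
      qPochInf_div_param_ne_zero ha hA hq (Finset.mem_Ioi.1 hj).ne
  have n3 := qPochInf_self_ne_zero hq
  have n4 : qPochInf (q * (∏ j, a j)⁻¹) q ≠ 0 := by
    refine qPochInf_ne_zero hq ?_
    rwa [norm_mul, norm_inv, ← div_eq_mul_inv, div_lt_one ((norm_nonneg q).trans_lt hA)]
  rw [askeyWilsonIntegral_eval hq a ha, jacksonReg_eq_prod hq ha hA hτ hs h0]
  simp only [hth, Finset.prod_mul_distrib]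
  rw [qTheta]
  generalize (∏ i, ∏ j ∈ Finset.Ioi i, qPochInf (a i * a j) q) = P at *
  generalize (∏ i, ∏ j ∈ Finset.Ioi i, qPochInf (q * (a i)⁻¹ * (a j)⁻¹) q) = R at *
  generalize qPochInf (q * (∏ j, a j)⁻¹) q = S at *
  field_simp

end

theorem mainTheorem6 (q : ℂ) (hq : ‖q‖ < 1) :
    -- the theta function identity
    (∀ x : Fin 4 → ℂ, (∀ k, x k ≠ 0) →
      (∀ i k, i ≠ k → qTheta (x i * x k) q ≠ 0 ∧ qTheta (x i / x k) q ≠ 0) →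
      ∑ k, qTheta ((x k ^ 2)⁻¹) q /
          ∏ i ∈ Finset.univ.erase k, (qTheta (x i * x k) q * qTheta (x i / x k) q) =
        2 * (qTheta (∏ k, x k) q / ∏ i, ∏ j ∈ Finset.Ioi i, qTheta (x i * x j) q)) ∧
    -- the Askey-Wilson integral as a multiple of Jackson's very-well-poised sum
    (∀ (τ : ℂ) (s a : Fin 4 → ℂ), Complex.exp τ = q → (∀ j, qPow τ (s j) = a j) →
      (∀ j, ‖a j‖ < 1) → ‖q‖ < ‖∏ j, a j‖ → a 0 ^ 2 ≠ q →
      Summable (fun ν : ℤ => jacksonQ τ s (s 0 + (ν : ℂ))) ∧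
      askeyWilsonIntegral q a =
        2 * qTheta (∏ j, a j) q /
            (qPochInf q q ^ 2 * ∏ i, ∏ j ∈ Finset.Ioi i, qTheta (a i * a j) q) *
          jacksonReg τ s (s 0) ∧
      jacksonReg τ s (s 0) =
        (∏ i, (qPochInf (q * a 0 * (a i)⁻¹) q * qPochInf (q * (a 0)⁻¹ * (a i)⁻¹) q)) /
            (qPochInf (q * a 0 ^ 2) q * qPochInf (q * (a 0 ^ 2)⁻¹) q) *
          basicHyp (r := 5)
            ![q * a 0, -(q * a 0), a 0 ^ 2, a 0 * a 1, a 0 * a 2, a 0 * a 3]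
            ![a 0, -a 0, q * a 0 / a 1, q * a 0 / a 2, q * a 0 / a 3]
            q (q / ∏ j, a j) ∧
      jacksonReg τ s (s 0) =
        qPochInf q q * (∏ i, ∏ j ∈ Finset.Ioi i, qPochInf (q * (a i)⁻¹ * (a j)⁻¹) q) /
          qPochInf (q * (∏ j, a j)⁻¹) q) ∧
    -- the Askey-Wilson evaluation
    (∀ a : Fin 4 → ℂ, (∀ j, ‖a j‖ < 1) →
      askeyWilsonIntegral q a =
        2 * qPochInf (∏ j, a j) q /
          (qPochInf q q * ∏ i, ∏ j ∈ Finset.Ioi i, qPochInf (a i * a j) q)) := by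
  refine ⟨fun x hx h => theta_identity hq x hx h, fun τ s a hτ hs ha hA h0 => ⟨?_, ?_, ?_, ?_⟩,
    fun a ha => askeyWilsonIntegral_eval hq a ha⟩
  · exact summable_jacksonQ hq ha hA hτ hs h0
  · exact askeyWilsonIntegral_eq_jacksonReg hq ha hA hτ hs h0
  · rw [basicHyp_eq_tsum_vwpTerm hq ha hA]
    exact jacksonReg_eq hq ha hA hτ hs h0
  · exact jacksonReg_eq_prod hq ha hA hτ hs h0
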